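/- All graphs are finite and simple. For a graph $G$, $\chi(G)$ is its chromatic number and $\omega(G)$ the maximum size of a clique. A class $\mathcal C$ of graphs is $\chi$-bounded if there is a function $f:\mathbb N\to\mathbb N$ such that $\chi(H)\le f(\omega(H))$ for every induced subgraph $H$ of every graph $G\in\mathcal C$. The local complementation of $G$ at a vertex $v$ replaces the subgraph induced on the neighbourhood of $v$ by its complement. A graph $H$ is a vertex-minor of $G$ if $H$ can be obtained from $G$ by a (possibly empty) finite sequence of local complementations and vertex deletions. The fan $F_k$ consists of an induced path on $k$ vertices and one additional vertex adjacent to all vertices of the path. For positive integers $a,b$, $R(a,b)$ is the Ramsey number: the least integer $n$ such that every graph with at least $n$ vertices contains a clique of size $a$ or an independent set of size $b$. Theorem. Let $k\ge 0$ be an integer. (1) The class of graphs having no vertex-minor isomorphic to $F_k$ is $\chi$-bounded. (2) If $k\le 2$, then every graph with no vertex-minor isomorphic to $F_k$ is $2$-colourable. (3) If $k\ge 3$, put $$\ell:=R(k,k)^{2(k-1)^2-1}+1,\qquad m:=(k-1)^{(k-1)^{2R(k+1,\,k\ell)+1}+1}.$$ Then for every integer $q\ge 1$, every graph $G$ with $\omega(G)\le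 q$ and no vertex-minor isomorphic to $F_k$ is $2(m-1)^{q-1}$-colourable. -/

import Mathlib

universe u v

/-- Local complementation `G * x`: the subgraph induced on the neighbourhood of `x` is replaced by
its complement, and all other adjacencies are kept. -/
def SimpleGraph.localComplement {V : Type u} (G : SimpleGraph V) (x : V) : SimpleGraph V where
  Adj a b := (G.Adj x a ∧ G.Adj x b ∧ a ≠ b ∧ ¬ G.Adj a b) ∨
    (¬ (G.Adj x a ∧ G.Adj x b) ∧ G.Adj a b)
  symm := ⟨fun a b h => by
    rcases h with ⟨h1, h2, h3, h4⟩ | ⟨h1, h2⟩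
    · exact Or.inl ⟨h2, h1, h3.symm, fun h => h4 h.symm⟩
    · exact Or.inr ⟨fun h => h1 ⟨h.2, h.1⟩, h2.symm⟩⟩
  loopless := ⟨fun a h => by
    rcases h with ⟨_, _, h, _⟩ | ⟨_, h⟩
    · exact h rfl
    · exact G.loopless.irrefl a h⟩

/-- `HasVertexMinor H G`: the graph `G` has a vertex-minor isomorphic to `H`, that is, a graph
isomorphic to `H` is obtained from `G` by a (possibly empty) finite sequence of local
complementations and vertex deletions. -/
inductive HasVertexMinor {W : Type v} (H : SimpleGraph W) :
    ∀ {V : Type u}, SimpleGraph V → Prop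
  | of_iso {V : Type u} (G : SimpleGraph V) (e : G ≃g H) : HasVertexMinor H G
  | of_localComplement {V : Type u} (G : SimpleGraph V) (x : V)
      (h : HasVertexMinor H (G.localComplement x)) : HasVertexMinor H G
  | of_delete {V : Type u} (G : SimpleGraph V) (x : V)
      (h : HasVertexMinor H (G.induce {x}ᶜ)) : HasVertexMinor H G

/-- The fan `F_k`: an induced path on the `k` vertices `some i`, together with a vertex `none`
adjacent to all of them. -/
def fan (k : ℕ) : SimpleGraph (Option (Fin k)) where
  Adj
    | none, none => False
    | none, some _ => True
    | some _, none => True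
    | some i, some j => (SimpleGraph.pathGraph k).Adj i j
  symm := ⟨fun a b h => by
    cases a <;> cases b <;> first | exact h | exact SimpleGraph.Adj.symm h⟩
  loopless := ⟨fun a h => by
    cases a
    · exact h
    · exact (SimpleGraph.pathGraph k).loopless.irrefl _ h⟩

/-- A class of (finite simple) graphs is `χ`-bounded if there is a function `f : ℕ → ℕ` with
`χ(H) ≤ f (ω(H))` for every induced subgraph `H` of every member of the class. -/
def IsChiBounded (C : ∀ V : Type u, SimpleGraph V → Prop) : Prop :=
  ∃ f : ℕ → ℕ, ∀ (V : Type u) [Finite V] (G : SimpleGraph V), C V G →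
    ∀ S : Set V, (G.induce S).chromaticNumber ≤ (f (G.induce S).cliqueNum : ℕ∞)

/-- The Ramsey number `R(a, b)`: the least `n` such that every graph with at least `n` vertices has
a clique of size `a` or an independent set of size `b`. -/
noncomputable def ramseyNumber (a b : ℕ) : ℕ :=
  sInf {n : ℕ | ∀ (V : Type) [Fintype V] (G : SimpleGraph V), n ≤ Fintype.card V →
    (∃ s : Finset V, G.IsNClique a s) ∨ (∃ s : Finset V, G.IsNIndepSet b s)}

/-- `ℓ(k) = R(k, k) ^ (2 (k - 1) ^ 2 - 1) + 1`. -/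
noncomputable def fanEll (k : ℕ) : ℕ :=
  ramseyNumber k k ^ (2 * (k - 1) ^ 2 - 1) + 1

/-- `m(k) = (k - 1) ^ ((k - 1) ^ (2 R(k + 1, k ℓ(k)) + 1) + 1)`. -/
noncomputable def fanM (k : ℕ) : ℕ :=
  (k - 1) ^ ((k - 1) ^ (2 * ramseyNumber (k + 1) (k * fanEll k) + 1) + 1)

/-! Split a connected graph into distance levels from a root `o`. Adjacent vertices lie in equal or
consecutive levels, so two disjoint palettes, alternating by parity, reduce the problem to colouring
one level. By Gyárfás' argument (`colorableOn_of_forall_path`) a level needs few colours unless it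
contains a long induced path, so the core is `HasVertexMinor.fan_of_level`: a long induced path in
level `t` forces a fan.

If a vertex of level `t - 1` has `k` neighbours on the path, the other path vertices can be shortcut
away, leaving a fan. Otherwise `exists_blocks` gives many disjoint blocks of the path, each with its
own attached vertex in level `t - 1`; let `S` be the set of these vertices. The aim is a hub `w` in
level `t - 2` with many neighbours in `S`. If there is none at once, `exists_private` gives a large
set `D` in level `t - 2` with private neighbours in `S`. The levels below make `D` connected, and
they can be eliminated by local complementations that affect neither `S` nor the path. A large
connected graph has a vertex of large degree or a long induced path, and either one can be turned
into a hub. Ramsey's theorem makes `k` of the hub's neighbours independent, and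
`HasVertexMinor.fan_of_blocks` turns each of them into a neighbour of `w` on a modified path.

This yields an explicit bound, which `pow_le_fanM` compares with `fanM`. -/

namespace SimpleGraph

/-! ### Vertex-minors and controlled local complementation -/

section VertexMinor

variable {V : Type u} {W : Type v} {H : SimpleGraph W}

theorem localComplement_adj (G : SimpleGraph V) (x a b : V) :
    (G.localComplement x).Adj a b ↔ (G.Adj x a ∧ G.Adj x b ∧ a ≠ b ∧ ¬ G.Adj a b) ∨
      (¬ (G.Adj x a ∧ G.Adj x b) ∧ G.Adj a b) := Iff.rfl

theorem localComplement_adj_of_not_adj (G : SimpleGraph V) {x a : V} (h : ¬ G.Adj x a) (b : V) :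
    (G.localComplement x).Adj a b ↔ G.Adj a b := by
  rw [localComplement_adj]; tauto

/-- Local complementation commutes with isomorphisms. -/
def Iso.localComplement {V' : Type*} {G : SimpleGraph V} {G' : SimpleGraph V'} (e : G ≃g G')
    (x : V) : G.localComplement x ≃g G'.localComplement (e x) where
  toEquiv := e.toEquiv
  map_rel_iff' := by
    intro a b
    simp only [localComplement_adj]
    simp [e.map_adj_iff]

/-- An isomorphism restricts to the vertex-deleted subgraphs. -/
def Iso.induceCompl {V' : Type*} {G : SimpleGraph V} {G' : SimpleGraph V'} (e : G ≃g G')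
    (x : V) : G.induce {x}ᶜ ≃g G'.induce {e x}ᶜ where
  toEquiv := e.toEquiv.subtypeEquiv (by simp)
  map_rel_iff' := by
    intro a b
    simp [e.map_adj_iff]

theorem _root_.HasVertexMinor.iso {G : SimpleGraph V} (h : HasVertexMinor H G) :
    ∀ {V' : Type u} {G' : SimpleGraph V'}, G ≃g G' → HasVertexMinor H G' := by
  induction h with
  | of_iso G f => exact fun e => .of_iso _ (e.symm.trans f)
  | of_localComplement G x _ ih =>
    exact fun e => .of_localComplement _ (e x) (ih (e.localComplement x))
  | of_delete G x _ ih => exact fun e => .of_delete _ (e x) (ih (e.induceCompl x))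

theorem _root_.HasVertexMinor.of_induce : ∀ {V : Type u} [Finite V] (G : SimpleGraph V)
    (S : Set V), HasVertexMinor H (G.induce S) → HasVertexMinor H G := by
  suffices ∀ (n : ℕ) {V : Type u} [Finite V] (G : SimpleGraph V) (S : Set V), Nat.card V = n →
      HasVertexMinor H (G.induce S) → HasVertexMinor H G from fun {_} _ G S h => this _ G S rfl h
  intro n
  induction n using Nat.strong_induction_on with
  | _ n ih =>
    intro V _ G S hn h
    by_cases hS : S = Set.univ
    · subst hS
      exact h.iso (induceUnivIso G)
    · obtain ⟨x, hx⟩ := (Set.ne_univ_iff_exists_notMem S).1 hS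
      refine .of_delete G x (ih (Nat.card ({x}ᶜ : Set V)) ?_ (G.induce {x}ᶜ)
        (Subtype.val ⁻¹' S) rfl (h.iso ?_))
      · rw [← hn]
        exact Finite.card_subtype_lt (x := x) (by simp)
      · exact
          { toFun := fun a => ⟨⟨a.1, fun hax => hx (by simpa using hax ▸ a.2)⟩, a.2⟩
            invFun := fun a => ⟨a.1.1, a.2⟩
            left_inv := fun _ => rfl
            right_inv := fun _ => rfl
            map_rel_iff' := Iff.rfl }

theorem _root_.HasVertexMinor.of_embedding [Finite V] {G : SimpleGraph V} (φ : H ↪g G) :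
    HasVertexMinor H G :=
  .of_induce G (Set.range φ) (.of_iso _ (φ.isoInduceRange.symm))

/-- `LocalReach Q G G'`: the graph `G'` is obtained from `G` by local complementations at vertices
without neighbours in `Q`. -/
inductive LocalReach (Q : Set V) : SimpleGraph V → SimpleGraph V → Prop
  | refl (G : SimpleGraph V) : LocalReach Q G G
  | step {G G' : SimpleGraph V} (x : V) (hx : ∀ p ∈ Q, ¬ G.Adj x p)
      (h : LocalReach Q (G.localComplement x) G') : LocalReach Q G G'

variable {Q : Set V} {G G' G'' : SimpleGraph V}

theorem LocalReach.trans (h : LocalReach Q G G') (h' : LocalReach Q G' G'') :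
    LocalReach Q G G'' := by
  induction h with
  | refl => exact h'
  | step x hx _ ih => exact .step x hx (ih h')

theorem LocalReach.mono {Q' : Set V} (hQ : Q' ⊆ Q) (h : LocalReach Q G G') :
    LocalReach Q' G G' := by
  induction h with
  | refl => exact .refl _
  | step x hx _ ih => exact .step x (fun p hp => hx p (hQ hp)) ih

/-- Complementing at `x` changes only pairs inside the neighbourhood of `x`, which misses `Q`. This
is how the path is protected while the lower levels are modified. -/
theorem LocalReach.adj_iff (h : LocalReach Q G G') {p : V} (hp : p ∈ Q) (b : V) :
    G'.Adj p b ↔ G.Adj p b := by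
  induction h with
  | refl => rfl
  | step x hx _ ih => rw [ih, localComplement_adj_of_not_adj _ (hx p hp)]

theorem LocalReach.adj_iff' (h : LocalReach Q G G') {p : V} (hp : p ∈ Q) (b : V) :
    G'.Adj b p ↔ G.Adj b p := by
  rw [adj_comm, h.adj_iff hp, adj_comm]

theorem _root_.HasVertexMinor.of_localReach (h : LocalReach Q G G') (h' : HasVertexMinor H G') :
    HasVertexMinor H G := by
  induction h with
  | refl => exact h'
  | step x _ _ ih => exact .of_localComplement _ x (ih h')

end VertexMinor

/-! ### Induced paths and fans -/

section InducedPath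

variable {V : Type u} {G : SimpleGraph V}

/-- The list `l` is the vertex sequence of an induced path of `G`. -/
def IsInducedPath (G : SimpleGraph V) : List V → Prop
  | [] => True
  | a :: l => (∀ b ∈ l, a ≠ b ∧ (G.Adj a b ↔ l.head? = some b)) ∧ IsInducedPath G l

theorem isInducedPath_cons {a : V} {l : List V} : G.IsInducedPath (a :: l) ↔
    (∀ b ∈ l, a ≠ b ∧ (G.Adj a b ↔ l.head? = some b)) ∧ G.IsInducedPath l := Iff.rfl

theorem isInducedPath_append {l₁ l₂ : List V} : G.IsInducedPath (l₁ ++ l₂) ↔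
    G.IsInducedPath l₁ ∧ G.IsInducedPath l₂ ∧ ∀ x ∈ l₁, ∀ y ∈ l₂, x ≠ y ∧
      (G.Adj x y ↔ l₁.getLast? = some x ∧ l₂.head? = some y) := by
  induction l₁ with
  | nil => simp [IsInducedPath]
  | cons a l ih =>
    rw [List.cons_append, isInducedPath_cons, ih, isInducedPath_cons]
    cases l with
    | nil => grind [IsInducedPath]
    | cons b l => grind [IsInducedPath]

theorem IsInducedPath.infix {l₁ l₂ : List V} (h : G.IsInducedPath l₂) (hl : l₁ <:+: l₂) :
    G.IsInducedPath l₁ := by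
  obtain ⟨s, t, rfl⟩ := hl
  rw [isInducedPath_append, isInducedPath_append] at h
  exact h.1.2.1

theorem IsInducedPath.congr {G' : SimpleGraph V} {l : List V} (h : G.IsInducedPath l)
    (hG : ∀ x ∈ l, ∀ y ∈ l, G'.Adj x y ↔ G.Adj x y) : G'.IsInducedPath l := by
  induction l with
  | nil => trivial
  | cons a l ih =>
    rw [isInducedPath_cons] at h ⊢
    refine ⟨fun b hb => ⟨(h.1 b hb).1, ?_⟩, ih h.2 fun x hx y hy => hG x (by simp [hx]) y
      (by simp [hy])⟩
    rw [hG a (by simp) b (by simp [hb]), (h.1 b hb).2]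

theorem IsInducedPath.getElem_adj {l : List V} (h : G.IsInducedPath l) :
    ∀ (i j : ℕ) (hi : i < l.length) (hj : j < l.length), (l[i] = l[j] → i = j) ∧
      (G.Adj l[i] l[j] ↔ i + 1 = j ∨ j + 1 = i) := by
  induction l with
  | nil => simp
  | cons a l ih =>
    rw [isInducedPath_cons] at h
    have ih := ih h.2
    have key : ∀ j (hj : j < l.length), a ≠ l[j] ∧ (G.Adj a l[j] ↔ j = 0) := by
      intro j hj
      refine ⟨(h.1 l[j] (by simp)).1, ?_⟩
      rw [(h.1 l[j] (by simp)).2, List.head?_eq_getElem?,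
        List.getElem?_eq_getElem (by omega : 0 < l.length)]
      have := ih j 0 hj (by omega)
      grind
    intro i j hi hj
    rcases i with _ | i <;> rcases j with _ | j
    · simp
    · have := key j (by simpa using hj)
      simp only [List.getElem_cons_zero, List.getElem_cons_succ]
      grind
    · have := key i (by simpa using hi)
      simp only [List.getElem_cons_zero, List.getElem_cons_succ]
      grind [SimpleGraph.adj_comm]
    · have := ih i j (by simpa using hi) (by simpa using hj)
      simp only [List.getElem_cons_succ]
      grind

/-- On the path, `x` has at most its two path neighbours; these are nonadjacent, and complementing
at `x` joins them. -/
theorem IsInducedPath.shortcut {l₁ l₂ : List V} {x : V} (h : G.IsInducedPath (l₁ ++ x :: l₂)) :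
    (G.localComplement x).IsInducedPath (l₁ ++ l₂) := by
  simp only [isInducedPath_append, isInducedPath_cons] at h ⊢
  obtain ⟨h1, ⟨h2, h3⟩, h4⟩ := h
  have hl : ∀ y ∈ l₁, x ≠ y ∧ (G.Adj x y ↔ l₁.getLast? = some y) := fun y hy => by
    have := h4 y hy x (by simp)
    rw [adj_comm]
    simp at this
    exact ⟨fun e => this.1 e.symm, this.2⟩
  refine ⟨h1.congr ?_, h3.congr ?_, ?_⟩
  · intro a ha b hb
    rw [localComplement_adj]
    have := hl a ha
    have := hl b hb
    have : ¬ G.Adj a a := G.loopless.irrefl a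
    grind
  · intro a ha b hb
    rw [localComplement_adj]
    have := h2 a ha
    have := h2 b hb
    have : ¬ G.Adj a a := G.loopless.irrefl a
    grind
  · intro a ha b hb
    rw [localComplement_adj]
    have := hl a ha
    have := h2 b hb
    have := h4 a ha b (by simp [hb])
    grind

theorem _root_.HasVertexMinor.fan_of_forall_adj [Finite V] {k : ℕ} {u : V} {l : List V}
    (h : G.IsInducedPath l) (hk : k ≤ l.length) (hu : ∀ x ∈ l, G.Adj u x) :
    HasVertexMinor (fan k) G := by
  have key := h.getElem_adj
  have hmem : ∀ i : Fin k, G.Adj u (l[i.1]'(by omega)) := fun i => hu _ (List.getElem_mem _)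
  let f : Option (Fin k) → V := fun o => o.elim u fun i => l[i.1]'(by omega)
  have hf : ∀ a b, G.Adj (f a) (f b) ↔ (fan k).Adj a b := by
    rintro (_ | i) (_ | j)
    · simp [fan, f]
    · simpa [fan, f] using hmem j
    · simpa [fan, f] using (hmem i).symm
    · simpa [fan, f, pathGraph_adj] using (key i j (by omega) (by omega)).2
  refine .of_embedding ⟨⟨f, ?_⟩, hf _ _⟩
  rintro (_ | i) (_ | j) hij
  · rfl
  · exact absurd hij (hmem j).ne
  · exact absurd hij.symm (hmem i).ne
  · have := (key i j (by omega) (by omega)).1 hij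
    simp [Fin.ext_iff, this]

open Classical in
/-- A vertex with at least `k` neighbours on an induced path yields a fan. -/
theorem _root_.HasVertexMinor.fan_of_countP [Finite V] {k : ℕ} {u : V} {l : List V}
    (h : G.IsInducedPath l) (hul : u ∉ l) (hk : k ≤ l.countP (G.Adj u ·)) :
    HasVertexMinor (fan k) G := by
  induction hn : l.length generalizing G l with
  | zero =>
    have := List.countP_le_length (p := (G.Adj u ·)) (l := l)
    exact .fan_of_forall_adj h (u := u) (by omega) (by simp [List.length_eq_zero_iff.1 hn])
  | succ n ih =>
    by_cases hall : ∀ x ∈ l, G.Adj u x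
    · exact .fan_of_forall_adj h (hk.trans List.countP_le_length) hall
    · push Not at hall
      obtain ⟨x, hx, hux⟩ := hall
      obtain ⟨l₁, l₂, rfl⟩ := List.append_of_mem hx
      -- As `x` is not adjacent to `u`, shortcutting it leaves the neighbours of `u` unchanged.
      refine .of_localComplement _ x (ih h.shortcut (by grind) ?_ (by grind))
      have : ((G.localComplement x).Adj u ·) = (G.Adj u ·) := funext fun y => propext <|
        localComplement_adj_of_not_adj _ (fun hx => hux hx.symm) _
      simp only [this]
      simpa [hux] using hk

end InducedPath

/-! ### Blocks of a path with private attachments -/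

section Blocks

variable {V : Type u} {G : SimpleGraph V}

open Classical in
theorem exists_chunks (A : Set V) (c q n : ℕ) (l : List V) (hl : n * q ≤ l.length)
    (hq : ∀ l', l' <:+: l → l'.length = q → ∃ s ∈ A, c ≤ l'.countP (G.Adj s ·)) :
    ∃ bs : List (V × List V), bs.length = n ∧ bs.flatMap Prod.snd <+: l ∧
      ∀ x ∈ bs, x.1 ∈ A ∧ c ≤ x.2.countP (G.Adj x.1 ·) := by
  induction n generalizing l with
  | zero => exact ⟨[], by simp⟩
  | succ n ih =>
    have hql : q ≤ l.length := le_trans (by nlinarith) hl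
    obtain ⟨bs, h1, h2, h3⟩ := ih (l.drop q) (by rw [List.length_drop, Nat.succ_mul] at *; omega)
      fun l' hl' => hq l' (hl'.trans (List.drop_suffix q l).isInfix)
    obtain ⟨s, hs, hc⟩ := hq (l.take q) (List.take_prefix q l).isInfix (by simpa using hql)
    refine ⟨(s, l.take q) :: bs, by simp [h1], ?_, ?_⟩
    · rw [List.flatMap_cons]
      nth_rw 2 [← List.take_append_drop q l]
      exact (List.prefix_append_right_inj _).2 h2
    · simp only [List.mem_cons]
      rintro x (rfl | hx)
      · exact ⟨hs, hc⟩
      · exact h3 x hx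

open Classical in
-- The vertex paired with a block already has `c` neighbours there, which exhausts its total
-- allowance.
theorem pairwise_of_countP_le {c : ℕ} {bs : List (V × List V)} {A : Set V}
    (h1 : ∀ x ∈ bs, x.1 ∈ A ∧ c ≤ x.2.countP (G.Adj x.1 ·))
    (h2 : ∀ s ∈ A, (bs.flatMap Prod.snd).countP (G.Adj s ·) ≤ c) :
    bs.Pairwise fun x y => (∀ p ∈ y.2, ¬ G.Adj x.1 p) ∧ ∀ p ∈ x.2, ¬ G.Adj y.1 p := by
  induction bs with
  | nil => exact List.Pairwise.nil
  | cons x bs ih =>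
    simp only [List.flatMap_cons, List.countP_append] at h2
    refine List.Pairwise.cons ?_ (ih (fun y hy => h1 y (by simp [hy])) fun s hs =>
      le_trans (by omega) (h2 s hs))
    intro y hy
    have hle : ∀ s, y.2.countP (G.Adj s ·) ≤ (bs.flatMap Prod.snd).countP (G.Adj s ·) := by
      intro s
      obtain ⟨b1, b2, rfl⟩ := List.append_of_mem hy
      simp only [List.flatMap_append, List.flatMap_cons, List.countP_append]
      omega
    have hx := h1 x (by simp)
    have hy' := h1 y (by simp [hy])
    have hx2 := h2 _ hx.1
    have hy2 := h2 _ hy'.1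
    have e1 : y.2.countP (G.Adj x.1 ·) = 0 := by have := hle x.1; omega
    have e2 : x.2.countP (G.Adj y.1 ·) = 0 := by have := hle y.1; omega
    rw [List.countP_eq_zero] at e1 e2
    exact ⟨by simpa using e1, by simpa using e2⟩

open Classical in
/-- If each vertex of a long sequence has a neighbour in `A` and each vertex of `A` has few
neighbours on the sequence, then an interval of the sequence splits into blocks, each of which
has a vertex of `A` attached to this block and to no other block. -/
theorem exists_blocks (A : Set V) (d n : ℕ) (l : List V) (hl : n ^ d ≤ l.length)
    (hA : ∀ p ∈ l, ∃ s ∈ A, G.Adj s p) (hd : ∀ s ∈ A, l.countP (G.Adj s ·) ≤ d) :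
    ∃ bs : List (V × List V), bs.length = n ∧ bs.flatMap Prod.snd <:+: l ∧
      (∀ x ∈ bs, x.1 ∈ A ∧ ∃ p ∈ x.2, G.Adj x.1 p) ∧
      bs.Pairwise fun x y => (∀ p ∈ y.2, ¬ G.Adj x.1 p) ∧ ∀ p ∈ x.2, ¬ G.Adj y.1 p := by
  induction d generalizing l with
  | zero =>
    cases l with
    | nil => simp at hl
    | cons p l =>
      obtain ⟨s, hs, hsp⟩ := hA p (by simp)
      have := hd s hs
      simp [hsp] at this
  | succ d ih =>
    -- Either some interval of length `n ^ d` satisfies the smaller degree bound, or every such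
    -- interval contains `d + 1` neighbours of one vertex of `A`; then `n` consecutive intervals
    -- serve as blocks.
    by_cases hex : ∃ l', l' <:+: l ∧ l'.length = n ^ d ∧ ∀ s ∈ A, l'.countP (G.Adj s ·) ≤ d
    · obtain ⟨l', h1, h2, h3⟩ := hex
      obtain ⟨bs, e1, e2, e3⟩ := ih l' h2.ge (fun p hp => hA p (h1.subset hp)) h3
      exact ⟨bs, e1, e2.trans h1, e3⟩
    · push Not at hex
      obtain ⟨bs, e1, e2, e3⟩ := exists_chunks A (d + 1) (n ^ d) n l (by rwa [← Nat.pow_succ'])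
        fun l' h1 h2 => hex l' h1 h2
      refine ⟨bs, e1, e2.isInfix, fun x hx => ⟨(e3 x hx).1, ?_⟩,
        pairwise_of_countP_le e3
          fun s hs => (e2.sublist.countP_le).trans (hd s hs)⟩
      have := (e3 x hx).2
      have : 0 < x.2.countP (G.Adj x.1 ·) := by omega
      simpa [List.countP_pos_iff] using this

theorem exists_first_split {P : V → Prop} {l : List V} (h : ∃ p ∈ l, P p) :
    ∃ x a z, l = x ++ a :: z ∧ P a ∧ ∀ p ∈ x, ¬ P p := by
  induction l with
  | nil => simp at h
  | cons b l ih =>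
    by_cases hb : P b
    · exact ⟨[], b, l, rfl, hb, by simp⟩
    · obtain ⟨x, a, z, rfl, h1, h2⟩ := ih (by grind)
      exact ⟨b :: x, a, z, rfl, h1, by grind⟩

theorem exists_last_split {P : V → Prop} {l : List V} (h : ∃ p ∈ l, P p) :
    ∃ x a z, l = x ++ a :: z ∧ P a ∧ ∀ p ∈ z, ¬ P p := by
  obtain ⟨x, a, z, h1, h2, h3⟩ := exists_first_split (l := l.reverse) (P := P) (by simpa using h)
  refine ⟨z.reverse, a, x.reverse, ?_, h2, by simpa using h3⟩
  rw [← List.reverse_reverse l, h1]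
  simp

/-- The segment `y` is replaced by `s`. Since `y` is nonempty, `a` and `c` are nonadjacent, so no
complementation is needed. -/
theorem IsInducedPath.reroute {L R y : List V} {a c s : V}
    (h : G.IsInducedPath (L ++ a :: (y ++ c :: R))) (hy : y ≠ []) (ha : G.Adj s a)
    (hc : G.Adj s c) (hL : ∀ p ∈ L, ¬ G.Adj s p) (hR : ∀ p ∈ R, ¬ G.Adj s p)
    (hsL : s ∉ L) (hsR : s ∉ R) : G.IsInducedPath (L ++ a :: s :: c :: R) := by
  have := ha.ne
  have := hc.ne
  have := ha.symm
  simp only [isInducedPath_append, isInducedPath_cons] at h ⊢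
  obtain ⟨h1, ⟨h2, h3, ⟨h4, h5⟩, h6⟩, h7⟩ := h
  have h2c := h2 c (by simp)
  have h2R : ∀ p ∈ R, a ≠ p ∧ ¬ G.Adj a p := by
    intro p hp
    have := h2 p (by simp [hp])
    have hh := (h6 (y.head hy) (by simp) p (by simp [hp])).1
    refine ⟨this.1, fun hap => hh ?_⟩
    have := this.2.1 hap
    rw [List.head?_append_of_ne_nil _ hy, List.head?_eq_some_head hy] at this
    simpa using this
  have h2c' : ¬ G.Adj a c := by
    intro hac
    have hh := (h6 (y.head hy) (by simp) c (by simp)).1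
    have := h2c.2.1 hac
    rw [List.head?_append_of_ne_nil _ hy, List.head?_eq_some_head hy] at this
    exact hh (by simpa using this)
  have hL' : ∀ p ∈ L, ¬ G.Adj p s := fun p hp hh => hL p hp hh.symm
  refine ⟨h1, ⟨?_, ?_, h4, h5⟩, ?_⟩
  · grind
  · grind
  · intro x hx z hz
    have := h7 x hx
    grind

/-- Complementing at `s` destroys the edge `ac`, the only path edge between neighbours of `s`. -/
theorem IsInducedPath.insert {L R : List V} {a c s : V}
    (h : G.IsInducedPath (L ++ a :: c :: R)) (ha : G.Adj s a)
    (hc : G.Adj s c) (hL : ∀ p ∈ L, ¬ G.Adj s p) (hR : ∀ p ∈ R, ¬ G.Adj s p)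
    (hsL : s ∉ L) (hsR : s ∉ R) :
    (G.localComplement s).IsInducedPath (L ++ a :: s :: c :: R) := by
  have := ha.ne
  have := hc.ne
  have := ha.symm
  have hL' : ∀ p ∈ L, ¬ G.Adj p s := fun p hp hh => hL p hp hh.symm
  have hss : ¬ G.Adj s s := G.loopless.irrefl s
  simp only [isInducedPath_append, isInducedPath_cons] at h ⊢
  obtain ⟨h1, ⟨h2, h3, h4⟩, h5⟩ := h
  refine ⟨h1.congr ?_, ⟨?_, ?_, ?_, h4.congr ?_⟩, ?_⟩
  · intro x hx y hy
    exact localComplement_adj_of_not_adj _ (hL x hx) y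
  · simp only [localComplement_adj]; grind
  · simp only [localComplement_adj]; grind
  · simp only [localComplement_adj]; grind
  · intro x hx y hy
    exact localComplement_adj_of_not_adj _ (hR x hx) y
  · intro x hx z hz
    rw [localComplement_adj_of_not_adj _ (hL x hx) z]
    have := h5 x hx
    grind

open Classical in
/-- A vertex `w` adjacent to `k` independent vertices attached to pairwise distinct blocks of an
induced path yields a fan. -/
theorem _root_.HasVertexMinor.fan_of_blocks [Finite V] {k : ℕ} {w : V} {T : Set V}
    {bs : List (V × List V)} {L : List V}
    (h : G.IsInducedPath (L ++ bs.flatMap Prod.snd))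
    (hk : k ≤ L.countP (G.Adj w ·) + bs.countP (fun x => x.1 ∈ T))
    (hT : ∀ x ∈ bs, x.1 ∈ T → G.Adj w x.1 ∧ (∃ p ∈ x.2, G.Adj x.1 p) ∧
      (∀ p ∈ L, ¬ G.Adj x.1 p) ∧ x.1 ∉ L ∧ x.1 ∉ bs.flatMap Prod.snd)
    (hbs : bs.Pairwise fun x y => (x.1 ∈ T → ∀ p ∈ y.2, ¬ G.Adj x.1 p) ∧
      (y.1 ∈ T → ∀ p ∈ x.2, ¬ G.Adj y.1 p) ∧
      (x.1 ∈ T → y.1 ∈ T → x.1 ≠ y.1 ∧ ¬ G.Adj x.1 y.1))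
    (hwL : w ∉ L) (hw : w ∉ bs.flatMap Prod.snd)
    (hwb : ∀ p ∈ bs.flatMap Prod.snd, ¬ G.Adj w p) :
    HasVertexMinor (fan k) G := by
  induction bs generalizing G L with
  | nil => exact .fan_of_countP (by simpa using h) hwL (by simpa using hk)
  | cons x bs ih =>
    obtain ⟨s, b⟩ := x
    rw [List.pairwise_cons] at hbs
    obtain ⟨hb1, hb2⟩ := hbs
    simp only [List.flatMap_cons, List.mem_append, not_or] at h hw hT hwb
    -- A block whose vertex lies outside `T` joins the processed prefix `L` unchanged.
    by_cases hs : s ∈ T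
    swap
    · refine ih (L := L ++ b) (by simpa using h) ?_ ?_ hb2 (by grind) hw.2
        fun p hp => hwb p (Or.inr hp)
      · simp only [List.countP_cons, hs, List.countP_append] at hk ⊢
        simp at hk
        omega
      · intro x hx hxT
        have h1 := hT x (by simp [hx]) hxT
        have h2 := (hb1 x hx).2.1 hxT
        grind
    have hs1 := hT (s, b) (by simp) hs
    simp only at hs1
    obtain ⟨hws, hsb, hsL, hsL', hsb', hsbs'⟩ := hs1
    have hsbs : ∀ p ∈ bs.flatMap Prod.snd, ¬ G.Adj s p := by
      intro p hp
      obtain ⟨x, hx, hp⟩ := List.mem_flatMap.1 hp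
      exact (hb1 x hx).1 hs p hp
    have hsw := hws.ne
    have hss : ¬ G.Adj s s := G.loopless.irrefl s
    have hlc : ∀ {p : V}, ¬ G.Adj s p → ∀ q, ((G.localComplement s).Adj p q ↔ G.Adj p q) ∧
        ((G.localComplement s).Adj q p ↔ G.Adj q p) := fun hp q => by
      rw [adj_comm _ q, adj_comm _ q]
      exact ⟨localComplement_adj_of_not_adj _ hp q, localComplement_adj_of_not_adj _ hp q⟩
    have hTs : ∀ x ∈ bs, x.1 ∈ T → ¬ G.Adj s x.1 ∧ s ≠ x.1 := fun x hx hxT =>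
      ⟨((hb1 x hx).2.2 hs hxT).2, ((hb1 x hx).2.2 hs hxT).1⟩
    simp only [List.countP_cons, hs, decide_true, if_true] at hk
    -- the case in which a local complementation at `s` is made first
    have main : ∀ b', (G.localComplement s).IsInducedPath (L ++ b' ++ bs.flatMap Prod.snd) →
        (∀ p ∈ b', p ∈ b ∨ p = s) → (∃ p ∈ b', G.Adj s p) → HasVertexMinor (fan k) G := by
      intro b' hP hb' hb''
      refine .of_localComplement _ s (ih (L := L ++ b') hP ?_ ?_ ?_ ?_ hw.2 ?_)
      · have e1 : L.countP ((G.localComplement s).Adj w ·) = L.countP (G.Adj w ·) :=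
          List.countP_congr fun p hp => by simpa using (hlc (hsL p hp) w).2
        have e2 : 0 < b'.countP ((G.localComplement s).Adj w ·) := by
          obtain ⟨p, hp, hsp⟩ := hb''
          rw [List.countP_pos_iff]
          refine ⟨p, hp, ?_⟩
          have := hb' p hp
          have := hwb p
          simp only [localComplement_adj, decide_eq_true_eq]
          have := hws.symm
          grind
        rw [List.countP_append, e1]
        omega
      · intro x hx hxT
        have h1 := hT x (by simp [hx]) hxT
        have h2 := (hb1 x hx).2.1 hxT
        have h3 := hTs x hx hxT
        have h4 := hlc h3.1
        have h5 : ¬ G.Adj x.1 s := fun hh => h3.1 hh.symm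
        grind
      · refine hb2.imp_of_mem ?_
        intro x y hx hy hxy
        have h3 := hTs x hx
        have h4 := hTs y hy
        grind
      · grind
      · intro p hp
        rw [(hlc (hsbs p hp) w).2]
        exact hwb p (Or.inr hp)
    obtain ⟨x, a, z, rfl, ha, hx⟩ := exists_first_split hsb
    -- Let `a` and `c` be the first and last neighbours of `s` in the block. If they are
    -- consecutive, `s` is inserted after complementing; if not, `s` replaces the segment between
    -- them. Either way the prefix gains a neighbour of `w`. Independence keeps the remaining
    -- attached vertices nonadjacent to `s`.
    by_cases hz : ∃ p ∈ z, G.Adj s p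
    · obtain ⟨y, c, z, rfl, hc, hz⟩ := exists_last_split hz
      by_cases hy : y = []
      · subst hy
        refine main (x ++ a :: s :: c :: z) ?_ (by grind) ⟨a, by simp, ha⟩
        have := IsInducedPath.insert (L := L ++ x) (R := z ++ bs.flatMap Prod.snd) (s := s)
          (a := a) (c := c) (by simpa using h) ha hc (by grind) (by grind) (by grind) (by grind)
        simpa using this
      · have := IsInducedPath.reroute (L := L ++ x) (R := z ++ bs.flatMap Prod.snd) (s := s)
          (a := a) (c := c) (y := y) (by simpa using h) hy ha hc (by grind) (by grind) (by grind)
          (by grind)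
        refine ih (L := L ++ (x ++ a :: s :: c :: z)) (by simpa using this) ?_ ?_ hb2 (by grind)
          hw.2 fun p hp => hwb p (Or.inr hp)
        · have e2 : 0 < (x ++ a :: s :: c :: z).countP (G.Adj w ·) := by
            rw [List.countP_pos_iff]
            exact ⟨s, by simp, by simpa using hws⟩
          rw [List.countP_append]
          omega
        · intro x hx hxT
          have h1 := hT x (by simp [hx]) hxT
          have h2 := (hb1 x hx).2.1 hxT
          have h3 := hTs x hx hxT
          have h5 : ¬ G.Adj x.1 s := fun hh => h3.1 hh.symm
          clear ih main hb1 hT hlc hk this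
          refine ⟨h1.1, h1.2.1, ?_, ?_, h1.2.2.2.2.2⟩ <;> grind
    -- With `a` the only neighbour of `s` in the block, complementing at `s` joins `w` to `a` and
    -- leaves the path intact.
    · push Not at hz
      refine main (x ++ a :: z) ?_ (by grind) ⟨a, by simp, ha⟩
      refine IsInducedPath.congr (G := G) (by simpa using h) fun p hp q hq => ?_
      by_cases hsp : G.Adj s p
      · by_cases hsq : G.Adj s q
        · have hpa : p = a := by grind
          have hqa : q = a := by grind
          rw [hpa, hqa]
          exact iff_of_false ((G.localComplement s).loopless.irrefl a) (G.loopless.irrefl a)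
        · exact (hlc hsq p).2
      · exact (hlc hsp q).1

end Blocks

/-! ### Connectivity under vertex elimination; large connected graphs -/

section Connected

variable {V : Type u} {G : SimpleGraph V}

/-- The set `X` of vertices induces a connected (or empty) subgraph. -/
def ConnectedOn (G : SimpleGraph V) (X : Set V) : Prop :=
  ∀ c : V → Prop, (∀ a ∈ X, ∀ b ∈ X, G.Adj a b → c a → c b) → ∀ a ∈ X, ∀ b ∈ X, c a → c b

/-- If one side had no neighbour of `x`, it would be separated from the rest already in `X`. Only
edges not inside the neighbourhood of `x` are assumed to respect `c`, so this applies to separations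
of both `G - x` and `G * x - x`. -/
theorem ConnectedOn.exists_adj {X : Set V} {x : V} (h : G.ConnectedOn X) (hx : x ∈ X)
    {c : V → Prop} (hc : ∀ a ∈ X \ {x}, ∀ b ∈ X \ {x}, ¬ (G.Adj x a ∧ G.Adj x b) →
      G.Adj a b → c a → c b) {a b : V} (ha : a ∈ X \ {x}) (hb : b ∈ X \ {x}) (hca : c a)
    (hcb : ¬ c b) : (∃ y ∈ X \ {x}, G.Adj x y ∧ c y) ∧ ∃ y ∈ X \ {x}, G.Adj x y ∧ ¬ c y := by
  simp only [Set.mem_sdiff, Set.mem_singleton_iff] at *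
  constructor
  · by_contra hno
    push Not at hno
    refine hcb (h (fun z => c z ∧ z ≠ x) ?_ a ha.1 b hb.1 ⟨hca, ha.2⟩).1
    rintro p hp q hq hpq ⟨hcp, hpx⟩
    have hxp : ¬ G.Adj x p := fun hxp => hno p ⟨hp, hpx⟩ hxp hcp
    have hqx : q ≠ x := by rintro rfl; exact hxp hpq.symm
    exact ⟨hc p ⟨hp, hpx⟩ q ⟨hq, hqx⟩ (fun hh => hxp hh.1) hpq hcp, hqx⟩
  · by_contra hno
    push Not at hno
    have := h (fun z => c z ∨ z = x) ?_ a ha.1 b hb.1 (Or.inl hca)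
    · exact this.elim hcb hb.2
    rintro p hp q hq hpq hcp
    by_cases hqx : q = x
    · exact Or.inr hqx
    by_cases hxq : G.Adj x q
    · exact Or.inl (hno q ⟨hq, hqx⟩ hxq)
    rcases hcp with hcp | rfl
    · by_cases hpx : p = x
      · subst hpx; exact absurd hpq hxq
      · exact Or.inl (hc p ⟨hp, hpx⟩ q ⟨hq, hqx⟩ (fun hh => hxq hh.2) hpq hcp)
    · exact absurd hpq hxq

/-- Deleting a vertex keeps a graph connected, possibly after a local complementation at it. -/
theorem ConnectedOn.sdiff_singleton {X : Set V} {x : V} (h : G.ConnectedOn X) (hx : x ∈ X) :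
    G.ConnectedOn (X \ {x}) ∨ (G.localComplement x).ConnectedOn (X \ {x}) := by
  by_contra hcon
  rw [not_or] at hcon
  simp only [ConnectedOn] at hcon
  push Not at hcon
  obtain ⟨⟨c, hc, a, ha, b, hb, hca, hcb⟩, d, hd, a', ha', b', hb', hda, hdb⟩ := hcon
  obtain ⟨⟨y, hy, hxy, hcy⟩, z, hz, hxz, hcz⟩ := h.exists_adj hx
    (fun p hp q hq _ => hc p hp q hq) ha hb hca hcb
  obtain ⟨⟨y', hy', hxy', hdy⟩, z', hz', hxz', hdz⟩ := h.exists_adj hx (c := d)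
    (fun p hp q hq hn hpq => hd p hp q hq (Or.inr ⟨hn, hpq⟩)) ha' hb' hda hdb
  have hyz : ¬ G.Adj y z := fun hh => hcz (hc y hy z hz hh hcy)
  have hne : y ≠ z := by rintro rfl; exact hcz hcy
  have h1 : d y → d z := hd y hy z hz (Or.inl ⟨hxy, hxz, hne, hyz⟩)
  have h2 : d z → d y := hd z hz y hy (Or.inl ⟨hxz, hxy, hne.symm, fun hh => hyz hh.symm⟩)
  -- Neighbours of `x` separated by `d` are nonadjacent in `G * x`, hence adjacent in `G`. As `y`
  -- and `z` lie on the same side of `d`, a neighbour of `x` on the other side is adjacent in `G` to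
  -- both, contradicting that `c` separates them.
  have key : ∀ p ∈ X \ {x}, ∀ q ∈ X \ {x}, G.Adj x p → G.Adj x q → d p → ¬ d q → G.Adj p q := by
    intro p hp q hq hxp hxq hdp hdq
    by_contra hpq
    exact hdq (hd p hp q hq (Or.inl ⟨hxp, hxq, by rintro rfl; exact hdq hdp, hpq⟩) hdp)
  by_cases hdy' : d y
  · have e1 := key y hy z' hz' hxy hxz' hdy' hdz
    have e2 := key z hz z' hz' hxz hxz' (h1 hdy') hdz
    exact hcz (hc z' hz' z hz e2.symm (hc y hy z' hz' e1 hcy))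
  · have e1 := key y' hy' y hy hxy' hxy hdy hdy'
    have e2 := key y' hy' z hz hxy' hxz hdy fun hh => hdy' (h2 hh)
    exact hcz (hc y' hy' z hz e2 (hc y hy y' hy' e1.symm hcy))

open Classical in
theorem ConnectedOn.exists_localReach {Q D : Set V} (W : Finset V)
    (h : G.ConnectedOn ((W : Set V) ∪ D)) (hWD : ∀ x ∈ W, x ∉ D) (hW : ∀ x ∈ W, ∀ p ∈ Q, ¬ G.Adj x p) :
    ∃ G', LocalReach Q G G' ∧ G'.ConnectedOn D := by
  induction W using Finset.induction_on generalizing G with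
  | empty => exact ⟨G, .refl G, by simpa using h⟩
  | insert x W hx ih =>
    have hset : (((insert x W : Finset V) : Set V) ∪ D) \ {x} = (W : Set V) ∪ D := by
      have := hWD x (by simp)
      ext y
      simp only [Finset.coe_insert, Set.mem_sdiff, Set.mem_union, Set.mem_insert_iff,
        Finset.mem_coe, Set.mem_singleton_iff]
      grind
    have h' := h.sdiff_singleton (x := x) (by simp)
    rw [hset] at h'
    have hxQ := hW x (by simp)
    rcases h' with h' | h'
    · exact ih h' (fun y hy => hWD y (by simp [hy])) fun y hy => hW y (by simp [hy])
    · obtain ⟨G', h1, h2⟩ := ih h' (fun y hy => hWD y (by simp [hy])) fun y hy p hp => by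
        rw [adj_comm, localComplement_adj_of_not_adj _ (hxQ p hp), adj_comm]
        exact hW y (by simp [hy]) p hp
      exact ⟨G', .step x hxQ h1, h2⟩

open Classical in
/-- The set of vertices of `D` at distance at most `j` from `d` in the subgraph induced on `D`. -/
noncomputable def ballOn (G : SimpleGraph V) (D : Finset V) (d : V) : ℕ → Finset V
  | 0 => {d}
  | j + 1 => D.filter fun x => x ∈ ballOn G D d j ∨ ∃ y ∈ ballOn G D d j, G.Adj y x

open Classical in
theorem card_ballOn_le {D : Finset V} {d : V} {Δ : ℕ}
    (hΔ : ∀ x ∈ D, (D.filter (G.Adj x ·)).card ≤ Δ) (hd : d ∈ D) (j : ℕ) :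
    ballOn G D d j ⊆ D ∧ (ballOn G D d j).card ≤ (Δ + 1) ^ j := by
  induction j with
  | zero => simp [ballOn, hd]
  | succ j ih =>
    refine ⟨Finset.filter_subset _ _, ?_⟩
    have hsub : ballOn G D d (j + 1) ⊆
        (ballOn G D d j).biUnion fun y => insert y (D.filter (G.Adj y ·)) := by
      intro x hx
      simp only [ballOn, Finset.mem_filter, Finset.mem_biUnion, Finset.mem_insert] at hx ⊢
      obtain ⟨hxD, hx | ⟨y, hy, hyx⟩⟩ := hx
      · exact ⟨x, hx, Or.inl rfl⟩
      · exact ⟨y, hy, Or.inr ⟨hxD, hyx⟩⟩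
    calc (ballOn G D d (j + 1)).card ≤ _ := Finset.card_le_card hsub
      _ ≤ (ballOn G D d j).card * (Δ + 1) := Finset.card_biUnion_le_card_mul _ _ _ fun y hy =>
          (Finset.card_insert_le _ _).trans (Nat.succ_le_succ (hΔ y (ih.1 hy)))
      _ ≤ (Δ + 1) ^ (j + 1) := by rw [pow_succ]; exact Nat.mul_le_mul_right _ ih.2

open Classical in
theorem exists_isInducedPath_ballOn {D : Finset V} {d : V} (hd : d ∈ D) (j : ℕ) {x : V}
    (hx : x ∈ ballOn G D d j) (hxi : ∀ i < j, x ∉ ballOn G D d i) :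
    ∃ l, G.IsInducedPath (x :: l) ∧ l.length = j ∧
      ∀ y ∈ l, y ∈ D ∧ ∃ i < j, y ∈ ballOn G D d i := by
  induction j generalizing x with
  | zero => exact ⟨[], by simp [IsInducedPath]⟩
  | succ j ih =>
    simp only [ballOn, Finset.mem_filter] at hx
    obtain ⟨hxD, hx | ⟨y, hy, hyx⟩⟩ := hx
    · exact absurd hx (hxi j (by omega))
    have hstep : ∀ i z, z ∈ ballOn G D d i → G.Adj z x → x ∈ ballOn G D d (i + 1) := by
      intro i z hz hzx
      simp only [ballOn, Finset.mem_filter]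
      exact ⟨hxD, Or.inr ⟨z, hz, hzx⟩⟩
    obtain ⟨l, h1, h2, h3⟩ := ih hy fun i hi hyi => hxi (i + 1) (by omega) (hstep i y hyi hyx)
    have hyD : y ∈ D := by
      cases j with
      | zero => simp only [ballOn, Finset.mem_singleton] at hy; exact hy ▸ hd
      | succ j => exact (Finset.mem_filter.1 hy).1
    refine ⟨y :: l, ⟨?_, h1⟩, by simp [h2], ?_⟩
    · intro b hb
      rcases List.mem_cons.1 hb with rfl | hb
      · exact ⟨hyx.ne', by simp [hyx.symm]⟩
      · obtain ⟨-, i, hi, hbi⟩ := h3 b hb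
        refine ⟨by rintro rfl; exact hxi i (by omega) hbi, ?_⟩
        have hne := (h1.1 b hb).1
        refine iff_of_false (fun hh => hxi (i + 1) (by omega) (hstep i b hbi hh.symm)) ?_
        simpa using hne
    · intro b hb
      rcases List.mem_cons.1 hb with rfl | hb
      · exact ⟨hyD, j, by omega, hy⟩
      · obtain ⟨h, i, hi, hbi⟩ := h3 b hb
        exact ⟨h, i, by omega, hbi⟩

open Classical in
/-- A large connected graph has a vertex of large degree or a long induced path. -/
theorem ConnectedOn.exists_degree_or_path {D : Finset V} (h : G.ConnectedOn (D : Set V))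
    {Δ r : ℕ} (hD : (Δ + 1) ^ r < D.card) :
    (∃ d ∈ D, Δ < (D.filter (G.Adj d ·)).card) ∨
      ∃ l, G.IsInducedPath l ∧ (∀ x ∈ l, x ∈ D) ∧ r ≤ l.length := by
  by_cases hΔ : ∀ x ∈ D, (D.filter (G.Adj x ·)).card ≤ Δ
  swap
  · push Not at hΔ
    exact Or.inl hΔ
  right
  obtain ⟨d, hd⟩ : D.Nonempty := Finset.card_pos.1 (by omega)
  have hb := card_ballOn_le hΔ hd
  have hmono : ∀ i j, i ≤ j → ballOn G D d i ⊆ ballOn G D d j := by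
    intro i j hij
    induction hij with
    | refl => rfl
    | step _ ih =>
      intro x hx
      simp only [ballOn, Finset.mem_filter]
      exact ⟨(hb _).1 hx, Or.inl (ih hx)⟩
  obtain ⟨z, hzD, hz⟩ : ∃ z ∈ D, z ∉ ballOn G D d r := by
    by_contra hno
    push Not at hno
    have := Finset.card_le_card (show D ⊆ ballOn G D d r from hno)
    have := (hb r).2
    omega
  -- The ball of radius `r` is too small to be all of `D`, so by connectedness it is not closed
  -- under adjacency. A shortest path from the new vertex back to `d` is induced.
  obtain ⟨x, hx, hxr⟩ : ∃ x ∈ ballOn G D d (r + 1), x ∉ ballOn G D d r := by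
    by_contra hno
    push Not at hno
    refine hz (h (· ∈ ballOn G D d r) ?_ d hd z hzD (hmono 0 r (by omega) (by simp [ballOn])))
    intro a ha b hb hab haB
    refine hno b ?_
    simp only [ballOn, Finset.mem_filter]
    exact ⟨hb, Or.inr ⟨a, haB, hab⟩⟩
  obtain ⟨l, h1, h2, h3⟩ := exists_isInducedPath_ballOn hd (r + 1) hx fun i hi hxi =>
    hxr (hmono i r (by omega) hxi)
  refine ⟨x :: l, h1, ?_, by simp [h2]; omega⟩
  intro y hy
  rcases List.mem_cons.1 hy with rfl | hy
  · exact (hb _).1 hx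
  · exact (h3 y hy).1

end Connected

/-! ### Creating a hub with many prescribed neighbours -/

section Hub

variable {V : Type u} {G : SimpleGraph V}

/-- A path whose vertices have pairwise distinct private neighbours can be contracted by local
complementations to a single vertex adjacent to all these neighbours. -/
theorem exists_hub_of_path {P X : Set V} {f : V → V} {w : V} {l : List V}
    (h : G.IsInducedPath (w :: l)) (hf : ∀ d ∈ l, ∀ e ∈ l, G.Adj d (f e) ↔ d = e)
    (hwf : ∀ e ∈ l, ¬ G.Adj w (f e)) (hfl : ∀ e ∈ l, f e ∉ l) (hwX : ∀ x ∈ X, G.Adj w x)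
    (hX : ∀ x ∈ X, ∀ d ∈ l, d ≠ x ∧ ¬ G.Adj d x) (hP : ∀ d ∈ w :: l, ∀ p ∈ P, ¬ G.Adj d p) :
    ∃ G', LocalReach P G G' ∧ ∃ t ∈ w :: l, (∀ x ∈ X, G'.Adj t x) ∧ ∀ e ∈ l, G'.Adj t (f e) := by
  induction l generalizing G w X with
  | nil => exact ⟨G, .refl G, w, by simp, hwX, by simp⟩
  | cons d l ih =>
    have hwd : G.Adj w d := by simpa using (h.1 d (by simp)).2
    have hdl : ∀ y ∈ l, d ≠ y := fun y hy => (h.2.1 y hy).1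
    have hwl : ∀ y ∈ l, ¬ G.Adj w y := by
      intro y hy hwy
      have := (h.1 y (by simp [hy])).2.1 hwy
      simp only [List.head?_cons, Option.some.injEq] at this
      exact hdl y hy this
    have hlc : ∀ {p : V}, ¬ G.Adj w p → ∀ q, ((G.localComplement w).Adj p q ↔ G.Adj p q) ∧
        ((G.localComplement w).Adj q p ↔ G.Adj q p) := fun hp q => by
      rw [adj_comm _ q, adj_comm _ q]
      exact ⟨localComplement_adj_of_not_adj _ hp q, localComplement_adj_of_not_adj _ hp q⟩
    have hwP := hP w (by simp)
    -- Complementing at `w` passes its neighbours `X` to the next path vertex `d`, which keeps its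
    -- own `f d`; then `d` takes over the role of `w`.
    have hih := ih (G := G.localComplement w) (w := d) (X := insert (f d) X)
      ?_ ?_ ?_ ?_ ?_ ?_ ?_
    · obtain ⟨G', h1, t, ht, h2, h3⟩ := hih
      refine ⟨G', .step w hwP h1, t, List.mem_cons_of_mem _ ht,
        fun x hx => h2 x (Set.mem_insert_of_mem _ hx), ?_⟩
      intro e he
      rcases List.mem_cons.1 he with rfl | he
      · exact h2 _ (Set.mem_insert _ _)
      · exact h3 e he
    · refine h.2.congr fun x hx y hy => ?_
      by_cases hx' : x ∈ l
      · exact (hlc (hwl x hx') y).1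
      by_cases hy' : y ∈ l
      · exact (hlc (hwl y hy') x).2
      have hxd : x = d := by simpa [hx'] using hx
      have hyd : y = d := by simpa [hy'] using hy
      rw [hxd, hyd]
      exact iff_of_false ((G.localComplement w).loopless.irrefl d) (G.loopless.irrefl d)
    · intro a ha b hb
      rw [(hlc (hwl a ha) _).1, hf a (by simp [ha]) b (by simp [hb])]
    · intro e he
      rw [(hlc (hwf e (by simp [he])) _).2, hf d (by simp) e (by simp [he])]
      exact hdl e he
    · intro e he hel
      exact hfl e (by simp [he]) (by simp [hel])
    · rintro x (rfl | hx)
      · rw [(hlc (hwf d (by simp)) _).2, hf d (by simp) d (by simp)]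
      · exact Or.inl ⟨hwd, hwX x hx, hX x hx d (by simp)⟩
    · rintro x (rfl | hx) e he
      · rw [(hlc (hwl e he) _).1, hf e (by simp [he]) d (by simp)]
        refine ⟨?_, (hdl e he).symm⟩
        rintro rfl
        exact hfl d (by simp) (by simp [he])
      · rw [(hlc (hwl e he) _).1]
        exact hX x hx e (by simp [he])
    · intro a ha p hp
      rw [(hlc (hwP p hp) _).2]
      exact hP a (List.mem_cons_of_mem _ ha) p hp

open Classical in
/-- A star whose leaves have pairwise distinct private neighbours can be turned by local
complementations at the leaves so that its centre is adjacent to all these neighbours. -/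
theorem exists_hub_of_star {P X : Set V} {f : V → V} {w : V} (E : Finset V)
    (hwE : ∀ e ∈ E, G.Adj w e) (hE : ∀ d ∈ E, ∀ e ∈ E, ¬ G.Adj d e)
    (hf : ∀ d ∈ E, ∀ e ∈ E, G.Adj d (f e) ↔ d = e)
    (hwf : ∀ e ∈ E, w ≠ f e ∧ ¬ G.Adj w (f e)) (hwX : ∀ x ∈ X, G.Adj w x)
    (hX : ∀ x ∈ X, ∀ d ∈ E, ¬ G.Adj d x) (hP : ∀ d ∈ E, ∀ p ∈ P, ¬ G.Adj d p) :
    ∃ G', LocalReach P G G' ∧ (∀ x ∈ X, G'.Adj w x) ∧ ∀ e ∈ E, G'.Adj w (f e) := by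
  induction E using Finset.induction_on generalizing G X with
  | empty => exact ⟨G, .refl G, hwX, by simp⟩
  | insert d E hd ih =>
    have hlc : ∀ {p : V}, ¬ G.Adj d p → ∀ q, ((G.localComplement d).Adj p q ↔ G.Adj p q) ∧
        ((G.localComplement d).Adj q p ↔ G.Adj q p) := fun hp q => by
      rw [adj_comm _ q, adj_comm _ q]
      exact ⟨localComplement_adj_of_not_adj _ hp q, localComplement_adj_of_not_adj _ hp q⟩
    have hdE : ∀ e ∈ E, ¬ G.Adj d e := fun e he => hE d (by simp) e (by simp [he])
    have hde : ∀ e ∈ E, d ≠ e := fun e he => by rintro rfl; exact hd he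
    have hdf : ∀ e ∈ E, ¬ G.Adj d (f e) := fun e he => by
      rw [hf d (by simp) e (by simp [he])]; exact hde e he
    have hdd : G.Adj d (f d) := (hf d (by simp) d (by simp)).2 rfl
    have hdP := hP d (by simp)
    -- Both `w` and `f d` are neighbours of `d`, so complementing at `d` joins them.
    have hih := ih (G := G.localComplement d) (X := insert (f d) X)
      (fun e he => (hlc (hdE e he) _).2.2 (hwE e (by simp [he])))
      (fun a ha e he => by
        rw [(hlc (hdE e he) _).2]; exact hE a (by simp [ha]) e (by simp [he]))
      (fun a ha e he => by
        rw [(hlc (hdf e he) _).2]; exact hf a (by simp [ha]) e (by simp [he]))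
      (fun e he => by
        rw [(hlc (hdf e he) _).2]; exact hwf e (by simp [he]))
      ?_ ?_ ?_
    · obtain ⟨G', h1, h2, h3⟩ := hih
      refine ⟨G', .step d hdP h1, fun x hx => h2 x (Set.mem_insert_of_mem _ hx), ?_⟩
      intro e he
      rcases Finset.mem_insert.1 he with rfl | he
      · exact h2 _ (Set.mem_insert _ _)
      · exact h3 e he
    · rintro x (rfl | hx)
      · exact Or.inl ⟨(hwE d (by simp)).symm, hdd, hwf d (by simp)⟩
      · exact (hlc (hX x hx d (by simp)) _).2.2 (hwX x hx)
    · rintro x (rfl | hx) e he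
      · rw [(hlc (hdE e he) _).1, hf e (by simp [he]) d (by simp)]
        exact (hde e he).symm
      · rw [(hlc (hdE e he) _).1]
        exact hX x hx e (by simp [he])
    · intro e he p hp
      rw [(hlc (hdP p hp) _).2]
      exact hP e (by simp [he]) p hp

open Classical in
/-- A quantitative form of Ramsey's theorem. -/
theorem exists_isNClique_or_isNIndepSet (G : SimpleGraph V) (a b : ℕ) (S : Finset V)
    (hS : 2 ^ (a + b) ≤ S.card) :
    (∃ T ⊆ S, G.IsNClique a T) ∨ ∃ T ⊆ S, G.IsNIndepSet b T := by
  induction hn : a + b generalizing a b S with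
  | zero =>
    obtain rfl : a = 0 := by omega
    exact Or.inl ⟨∅, by simp, by simp⟩
  | succ n ih =>
    rcases a with _ | a
    · exact Or.inl ⟨∅, by simp, by simp⟩
    rcases b with _ | b
    · exact Or.inr ⟨∅, by simp, by simp [isNIndepSet_iff, IsIndepSet]⟩
    rw [hn, pow_succ] at hS
    have hpos : 0 < 2 ^ n := by positivity
    obtain ⟨v, hv⟩ : S.Nonempty := Finset.card_pos.1 (by omega)
    have hcard := Finset.card_filter_add_card_filter_not (s := S.erase v) (p := (G.Adj v ·))
    rw [Finset.card_erase_of_mem hv] at hcard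
    have hor : 2 ^ n ≤ ((S.erase v).filter (G.Adj v ·)).card ∨
        2 ^ n ≤ ((S.erase v).filter (¬ G.Adj v ·)).card := by
      by_contra hcon
      push Not at hcon
      omega
    rcases hor with h | h
    · have e : a + (b + 1) = n := by omega
      rcases ih a (b + 1) _ (by rwa [e]) e with ⟨T, hT, hT'⟩ | ⟨T, hT, hT'⟩
      · refine Or.inl ⟨insert v T, ?_, hT'.insert ?_⟩
        · exact Finset.insert_subset hv fun x hx => (Finset.mem_erase.1
            (Finset.mem_filter.1 (hT hx)).1).2
        · exact fun x hx => (Finset.mem_filter.1 (hT hx)).2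
      · exact Or.inr ⟨T, fun x hx => (Finset.mem_erase.1 (Finset.mem_filter.1 (hT hx)).1).2, hT'⟩
    · have e : (a + 1) + b = n := by omega
      rcases ih (a + 1) b _ (by rwa [e]) e with ⟨T, hT, hT'⟩ | ⟨T, hT, hT'⟩
      · exact Or.inl ⟨T, fun x hx => (Finset.mem_erase.1 (Finset.mem_filter.1 (hT hx)).1).2, hT'⟩
      · refine Or.inr ⟨insert v T, ?_, ?_⟩
        · exact Finset.insert_subset hv fun x hx => (Finset.mem_erase.1
            (Finset.mem_filter.1 (hT hx)).1).2
        · rw [← isNClique_compl] at hT' ⊢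
          refine hT'.insert fun x hx => ?_
          have := Finset.mem_filter.1 (hT hx)
          rw [compl_adj]
          exact ⟨(Finset.mem_erase.1 this.1).1.symm, this.2⟩

open Classical in
/-- Among many neighbours of `w`, there are `r` that are independent, possibly after a local
complementation at `w`. -/
theorem exists_indep_neighbors {P : Set V} {w : V} {r : ℕ} (E : Finset V)
    (hE : 2 ^ (r + r) ≤ E.card) (hwE : ∀ e ∈ E, G.Adj w e) (hwP : ∀ p ∈ P, ¬ G.Adj w p) :
    ∃ G', (G' = G ∨ G' = G.localComplement w) ∧ LocalReach P G G' ∧ ∃ T ⊆ E, T.card = r ∧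
      ∀ x ∈ T, ∀ y ∈ T, ¬ G'.Adj x y := by
  rcases G.exists_isNClique_or_isNIndepSet r r E hE with ⟨T, hT, hT'⟩ | ⟨T, hT, hT'⟩
  · refine ⟨_, Or.inr rfl, .step w hwP (.refl _), T, hT, hT'.card_eq, ?_⟩
    intro x hx y hy
    rw [localComplement_adj]
    have h1 := hwE x (hT hx)
    have h2 := hwE y (hT hy)
    rintro (⟨-, -, hne, hxy⟩ | ⟨hh, -⟩)
    · exact hxy (hT'.isClique hx hy hne)
    · exact hh ⟨h1, h2⟩
  · refine ⟨G, Or.inl rfl, .refl G, T, hT, hT'.card_eq, ?_⟩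
    intro x hx y hy hxy
    exact hT'.isIndepSet hx hy hxy.ne hxy

open Classical in
-- The size bound gives a vertex with more than `2 ^ (r + r)` neighbours in `D`, from which Ramsey
-- extracts a star with `r` independent leaves, or an induced path on at least `r` vertices. Both
-- structures collapse to a hub.
theorem exists_hub_of_connectedOn {P : Set V} {D : Finset V} {f : V → V} {r : ℕ}
    (h : G.ConnectedOn (D : Set V)) (hf : ∀ d ∈ D, ∀ e ∈ D, G.Adj d (f e) ↔ d = e)
    (hfD : ∀ e ∈ D, f e ∉ D) (hP : ∀ d ∈ D, ∀ p ∈ P, ¬ G.Adj d p)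
    (hD : (2 ^ (r + r) + 1) ^ r < D.card) :
    ∃ G', LocalReach P G G' ∧ ∃ w ∈ D, ∃ T : Finset V, r ≤ T.card ∧
      ∀ x ∈ T, x ∈ D.image f ∧ G'.Adj w x := by
  have hinj : ∀ d ∈ D, ∀ e ∈ D, f d = f e → d = e := fun d hd e he hde =>
    (hf d hd e he).1 (hde ▸ (hf d hd d hd).2 rfl)
  rcases h.exists_degree_or_path hD with ⟨w, hw, hdeg⟩ | ⟨l, hl, hlD, hlen⟩
  · have hwE : ∀ e ∈ D.filter (G.Adj w ·), G.Adj w e := fun e he => (Finset.mem_filter.1 he).2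
    obtain ⟨G₁, hG₁, h1, E, hE, hEr, hEi⟩ := exists_indep_neighbors (r := r) _ hdeg.le hwE
      (hP w hw)
    have hED : ∀ e ∈ E, e ∈ D := fun e he => (Finset.mem_filter.1 (hE he)).1
    have hwf : ∀ e ∈ E, ¬ G.Adj w (f e) := fun e he hh =>
      (hwE e (hE he)).ne ((hf w hw e (hED e he)).1 hh)
    have hG₁w : ∀ y, G₁.Adj w y ↔ G.Adj w y := by
      intro y
      rcases hG₁ with rfl | rfl
      · rfl
      · exact localComplement_adj_of_not_adj _ (G.loopless.irrefl w) y
    have hG₁f : ∀ e ∈ E, ∀ y, G₁.Adj y (f e) ↔ G.Adj y (f e) := by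
      intro e he y
      rcases hG₁ with rfl | rfl
      · rfl
      · rw [adj_comm, localComplement_adj_of_not_adj _ (hwf e he), adj_comm]
    obtain ⟨G₂, h2, -, h3⟩ := exists_hub_of_star (G := G₁) (P := P) (X := ∅) (w := w) (f := f) E
      (fun e he => (hG₁w e).2 (hwE e (hE he))) hEi
      (fun d hd e he => by rw [hG₁f e he, hf d (hED d hd) e (hED e he)])
      (fun e he => ⟨by rintro rfl; exact hfD e (hED e he) hw, by
        rw [hG₁f e he]; exact hwf e he⟩)
      (by simp) (by simp)
      (fun e he p hp => by rw [h1.adj_iff' hp]; exact hP e (hED e he) p hp)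
    refine ⟨G₂, h1.trans h2, w, hw, E.image f, ?_, ?_⟩
    · rw [Finset.card_image_of_injOn fun d hd e he => hinj d (hED d hd) e (hED e he), hEr]
    · intro x hx
      obtain ⟨e, he, rfl⟩ := Finset.mem_image.1 hx
      exact ⟨Finset.mem_image_of_mem _ (hED e he), h3 e he⟩
  · rcases l with _ | ⟨w, l⟩
    · obtain rfl : r = 0 := by simpa using hlen
      obtain ⟨d, hd⟩ : D.Nonempty := Finset.card_pos.1 (by omega)
      exact ⟨G, .refl G, d, hd, ∅, by simp⟩
    have hw := hlD w (by simp)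
    have hlD' : ∀ e ∈ l, e ∈ D := fun e he => hlD e (by simp [he])
    have hwl : ∀ e ∈ l, w ≠ e := fun e he => (hl.1 e he).1
    obtain ⟨G', h1, t, ht, h2, h3⟩ := exists_hub_of_path (P := P) (X := {f w}) (f := f) hl
      (fun d hd e he => hf d (hlD' d hd) e (hlD' e he))
      (fun e he => by rw [hf w hw e (hlD' e he)]; exact hwl e he)
      (fun e he hh => hfD e (hlD' e he) (hlD' _ hh))
      (by simpa using (hf w hw w hw).2 rfl)
      (by
        rintro x rfl d hd
        refine ⟨by rintro rfl; exact hfD w hw (hlD' _ hd), ?_⟩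
        rw [hf d (hlD' d hd) w hw]
        exact (hwl d hd).symm)
      (fun d hd p hp => hP d (hlD d hd) p hp)
    have hnd : (w :: l).Nodup := List.nodup_iff_injective_getElem.2 fun i j hij =>
      Fin.ext ((hl.getElem_adj i j i.2 j.2).1 hij)
    refine ⟨G', h1, t, hlD t ht, (w :: l).toFinset.image f, ?_, ?_⟩
    · rw [Finset.card_image_of_injOn fun d hd e he => hinj d (hlD d (by simpa using hd)) e
        (hlD e (by simpa using he)), List.toFinset_card_of_nodup hnd]
      exact hlen
    · intro x hx
      obtain ⟨e, he, rfl⟩ := Finset.mem_image.1 hx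
      rw [List.mem_toFinset] at he
      refine ⟨Finset.mem_image_of_mem _ (hlD e he), ?_⟩
      rcases List.mem_cons.1 he with rfl | he
      · exact h2 _ rfl
      · exact h3 e he

open Classical in
/-- If every vertex of `S` has a neighbour in `B` and each vertex of `B` has few neighbours in `S`,
then many vertices of `B` have pairwise distinct private neighbours in `S`. -/
theorem exists_private {B S : Finset V} {ρ : ℕ} (hS : ∀ s ∈ S, ∃ b ∈ B, G.Adj b s)
    (hB : ∀ b ∈ B, (S.filter (G.Adj b ·)).card ≤ ρ) :
    ∃ D ⊆ B, S.card ≤ D.card * ρ ∧ ∃ f : V → V, (∀ d ∈ D, f d ∈ S) ∧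
      ∀ d ∈ D, ∀ e ∈ D, G.Adj d (f e) ↔ d = e := by
  -- In a minimal subset of `B` dominating `S`, each vertex has a private neighbour, as otherwise it
  -- could be removed.
  obtain ⟨D, hD⟩ := (Finset.finite_toSet (B.powerset.filter fun D =>
    ∀ s ∈ S, ∃ b ∈ D, G.Adj b s)).exists_minimal ⟨B, by simpa using hS⟩
  have hDm := hD.1
  simp only [Finset.coe_filter, Finset.mem_powerset, Set.mem_ofPred_eq] at hDm
  obtain ⟨hDB, hDS⟩ := hDm
  refine ⟨D, hDB, ?_, ?_⟩
  · have hsub : S ⊆ D.biUnion fun d => S.filter (G.Adj d ·) := by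
      intro s hs
      obtain ⟨b, hb, hbs⟩ := hDS s hs
      exact Finset.mem_biUnion.2 ⟨b, hb, Finset.mem_filter.2 ⟨hs, hbs⟩⟩
    exact (Finset.card_le_card hsub).trans
      (Finset.card_biUnion_le_card_mul _ _ _ fun d hd => hB d (hDB hd))
  · have key : ∀ e ∈ D, ∃ s ∈ S, ∀ d ∈ D, G.Adj d s ↔ d = e := by
      intro e he
      by_contra hno
      push Not at hno
      have hmem : D.erase e ∈ (B.powerset.filter fun D => ∀ s ∈ S, ∃ b ∈ D, G.Adj b s) := by
        simp only [Finset.mem_filter, Finset.mem_powerset]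
        refine ⟨(Finset.erase_subset _ _).trans hDB, fun s hs => ?_⟩
        obtain ⟨b, hb, hbs⟩ := hDS s hs
        obtain ⟨d, hd, hds⟩ := hno s hs
        by_cases hbe : b = e
        · subst hbe
          rcases hds with ⟨h1, h2⟩ | ⟨h1, h2⟩
          · exact ⟨d, Finset.mem_erase.2 ⟨h2, hd⟩, h1⟩
          · exact absurd (h2 ▸ hbs) h1
        · exact ⟨b, Finset.mem_erase.2 ⟨hbe, hb⟩, hbs⟩
      have := hD.2 hmem (Finset.erase_subset _ _)
      exact Finset.notMem_erase e D (this he)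
    choose! f hf1 hf2 using key
    exact ⟨f, hf1, fun d hd e he => hf2 e he d hd⟩

end Hub

/-! ### Gyárfás' path argument -/

section Coloring

variable {V : Type u} {G : SimpleGraph V}

/-- The subgraph induced on `X` is `n`-colourable. -/
def ColorableOn (G : SimpleGraph V) (X : Set V) (n : ℕ) : Prop :=
  ∃ c : V → ℕ, (∀ a ∈ X, c a < n) ∧ ∀ a ∈ X, ∀ b ∈ X, G.Adj a b → c a ≠ c b

theorem ColorableOn.mono {X Y : Set V} {n : ℕ} (h : G.ColorableOn Y n) (hXY : X ⊆ Y) :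
    G.ColorableOn X n :=
  let ⟨c, h1, h2⟩ := h
  ⟨c, fun a ha => h1 a (hXY ha), fun a ha b hb => h2 a (hXY ha) b (hXY hb)⟩

theorem ConnectedOn.insert {Y : Set V} {y z : V} (h : G.ConnectedOn Y) (hy : y ∈ Y)
    (hyz : G.Adj y z) : G.ConnectedOn (insert z Y) := by
  intro c hc
  have h' := h c fun a ha b hb => hc a (Or.inr ha) b (Or.inr hb)
  have h1 := hc y (Or.inr hy) z (Or.inl rfl) hyz
  have h2 := hc z (Or.inl rfl) y (Or.inr hy) hyz.symm
  rintro a (rfl | ha) b (rfl | hb) hca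
  · exact hca
  · exact h' y hy b hb (h2 hca)
  · exact h1 (h' a ha y hy hca)
  · exact h' a ha b hb hca

/-- A set that is not `n`-colourable has a connected component that is not `n`-colourable. -/
theorem exists_component [Finite V] {E : Set V} {n : ℕ} (hE : ¬ G.ColorableOn E n) :
    ∃ Y ⊆ E, Y.Nonempty ∧ G.ConnectedOn Y ∧ (∀ y ∈ Y, ∀ z ∈ E, G.Adj y z → z ∈ Y) ∧
      ¬ G.ColorableOn Y n := by
  classical
  obtain ⟨C, hC⟩ := (Set.toFinite {C : Set V | C ⊆ E ∧ ¬ G.ColorableOn C n}).exists_minimal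
    ⟨E, subset_rfl, hE⟩
  obtain ⟨hCE, hCn⟩ := hC.1
  have hsub : ∀ C' ⊆ C, C' ≠ C → G.ColorableOn C' n := by
    intro C' h1 h2
    by_contra hcon
    exact h2 (subset_antisymm h1 (hC.2 ⟨h1.trans hCE, hcon⟩ h1))
  have hconn : G.ConnectedOn C := by
    intro c hc a ha b hb hca
    by_contra hcb
    obtain ⟨c₁, h1, h1'⟩ := hsub {x ∈ C | c x} (fun x hx => hx.1) fun h => by
      rw [← h] at hb; exact hcb hb.2
    obtain ⟨c₂, h2, h2'⟩ := hsub {x ∈ C | ¬ c x} (fun x hx => hx.1) fun h => by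
      rw [← h] at ha; exact ha.2 hca
    refine hCn ⟨fun x => if c x then c₁ x else c₂ x, fun x hx => ?_, fun x hx y hy hxy => ?_⟩
    · by_cases hcx : c x
      · simpa [hcx] using h1 x ⟨hx, hcx⟩
      · simpa [hcx] using h2 x ⟨hx, hcx⟩
    · have e1 := hc x hx y hy hxy
      have e2 := hc y hy x hx hxy.symm
      by_cases hcx : c x
      · simpa [hcx, e1 hcx] using h1' x ⟨hx, hcx⟩ y ⟨hy, e1 hcx⟩ hxy
      · have hcy : ¬ c y := fun h => hcx (e2 h)
        simpa [hcx, hcy] using h2' x ⟨hx, hcx⟩ y ⟨hy, hcy⟩ hxy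
  obtain ⟨x, hx⟩ : C.Nonempty := by
    rw [Set.nonempty_iff_ne_empty]
    rintro rfl
    exact hCn ⟨fun _ => 0, by simp, by simp⟩
  -- The minimal non-colourable set `C` is connected, so the component of `E` through one of its
  -- vertices contains all of `C`.
  let R : V → V → Prop := fun a b => b ∈ E ∧ G.Adj a b
  have hcl : ∀ y, Relation.ReflTransGen R x y → ∀ z ∈ E, G.Adj y z →
      Relation.ReflTransGen R x z := fun y hy z hz hyz => hy.tail ⟨hz, hyz⟩
  have hYE : ∀ y, Relation.ReflTransGen R x y → y ∈ E := by
    intro y hy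
    cases hy with
    | refl => exact hCE hx
    | tail _ h => exact h.1
  refine ⟨{y | Relation.ReflTransGen R x y}, hYE, ⟨x, .refl⟩, ?_, hcl, fun h => hCn (h.mono ?_)⟩
  · intro c hc
    have key : ∀ y, Relation.ReflTransGen R x y → (c x ↔ c y) := by
      intro y hy
      induction hy with
      | refl => rfl
      | tail h h' ih =>
        rw [ih]
        exact ⟨hc _ h _ (h.tail h') h'.2, hc _ (h.tail h') _ h h'.2.symm⟩
    exact fun a ha b hb hca => (key b hb).1 ((key a ha).2 hca)
  · exact fun y hy => hconn (Relation.ReflTransGen R x ·)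
      (fun a _ b hb hab haR => hcl a haR b (hCE hb) hab) x hx y hy .refl

/-- The path grows one vertex at a time: each step discards the neighbourhood of `v`, at a cost of
`c` colours, and enters a component of the rest that is still hard to colour through a neighbour `z`
of `v`. -/
theorem exists_path_of_not_colorableOn [Finite V] {c : ℕ} (hc : 1 ≤ c) (j : ℕ) {D : Set V} {v : V}
    (hv : v ∈ D) (hD : G.ConnectedOn D) (hDc : ¬ G.ColorableOn D (j * c))
    (hN : ∀ x ∈ D, G.ColorableOn {y ∈ D | G.Adj x y} c) :
    ∃ l, G.IsInducedPath (v :: l) ∧ (∀ x ∈ l, x ∈ D) ∧ l.length = j := by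
  classical
  induction j generalizing D v with
  | zero => exact ⟨[], by simp [IsInducedPath]⟩
  | succ j ih =>
    by_cases hE : G.ColorableOn {y ∈ D | y ≠ v ∧ ¬ G.Adj v y} (j * c)
    · obtain ⟨cE, hE1, hE2⟩ := hE
      -- For `j = 0` there is no old colour for `v` to reuse; but then every other vertex of `D` is
      -- a neighbour of `v`, and a single one suffices.
      rcases j with _ | j
      · obtain ⟨z, hz, hvz⟩ : ∃ z ∈ D, G.Adj v z := by
          by_contra hno
          push Not at hno
          have hDv : ∀ y ∈ D, y = v := fun y hy => by
            by_contra hyv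
            simpa using hE1 y ⟨hy, hyv, hno y hy⟩
          refine hDc ⟨fun _ => 0, fun _ _ => by simpa using Nat.pos_of_ne_zero (by omega : c ≠ 0), fun a ha b hb hab => ?_⟩
          rw [hDv a ha, hDv b hb] at hab
          exact absurd hab (G.loopless.irrefl v)
        refine ⟨[z], ?_, by simpa using hz, rfl⟩
        simp [IsInducedPath, hvz, hvz.ne]
      · obtain ⟨cN, hN1, hN2⟩ := hN v hv
        have hpos : 0 < (j + 1) * c := by positivity
        -- Neighbours of `v` get `c` fresh colours, so `v` may share colour `0` with its
        -- non-neighbours.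
        refine absurd ⟨fun y => if G.Adj v y then (j + 1) * c + cN y else
          if y = v then 0 else cE y, fun a ha => ?_, fun a ha b hb hab => ?_⟩ hDc
        · rw [Nat.succ_mul (j + 1) c]
          have h1 := hN1 a
          have h2 := hE1 a
          by_cases hva : G.Adj v a
          · have := h1 ⟨ha, hva⟩
            simp only [hva, if_true]
            omega
          · by_cases hav : a = v
            · simp only [hav, G.loopless.irrefl v, if_true, if_false]
              omega
            · have := h2 ⟨ha, hav, hva⟩
              simp only [hva, hav, if_false]
              omega
        · have hvv : ¬ G.Adj v v := G.loopless.irrefl v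
          have a1 := hE1 a
          have b1 := hE1 b
          have e1 := hE2 a
          have e2 := hN2 a
          simp only [Set.mem_ofPred_eq] at a1 b1 e1 e2
          by_cases hva : G.Adj v a <;> by_cases hvb : G.Adj v b
          · have := e2 ⟨ha, hva⟩ b ⟨hb, hvb⟩ hab
            simp only [hva, hvb, if_true]
            omega
          · simp only [hva, hvb, if_true, if_false]
            by_cases hbv : b = v
            · simp only [hbv, if_true]; omega
            · have := b1 ⟨hb, hbv, hvb⟩
              simp only [hbv, if_false]; omega
          · simp only [hva, hvb, if_true, if_false]
            by_cases hav : a = v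
            · simp only [hav, if_true]; omega
            · have := a1 ⟨ha, hav, hva⟩
              simp only [hav, if_false]; omega
          · have hav : a ≠ v := by rintro rfl; exact hvb hab
            have hbv : b ≠ v := by rintro rfl; exact hva hab.symm
            simp only [hva, hvb, hav, hbv, if_false]
            exact e1 ⟨ha, hav, hva⟩ b ⟨hb, hbv, hvb⟩ hab
    · obtain ⟨Y, hYE, ⟨y₀, hy₀⟩, hY, hYcl, hYc⟩ := exists_component hE
      obtain ⟨y, hy, z, hzD, hyz, hzY⟩ : ∃ y ∈ Y, ∃ z ∈ D, G.Adj y z ∧ z ∉ Y := by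
        by_contra hno
        push Not at hno
        have := hD (· ∈ Y) (fun a _ b hb hab haY => hno a haY b hb hab) y₀ (hYE hy₀).1 v hv hy₀
        exact (hYE this).2.1 rfl
      have hvz : G.Adj v z := by
        by_contra hvz
        by_cases hzv : z = v
        · subst hzv
          exact (hYE hy).2.2 hyz.symm
        · exact hzY (hYcl y hy z ⟨hzD, hzv, hvz⟩ hyz)
      have hsub : insert z Y ⊆ D := by
        rintro a (rfl | ha)
        · exact hzD
        · exact (hYE ha).1
      obtain ⟨l, h1, h2, h3⟩ := ih (D := insert z Y) (v := z) (Or.inl rfl) (hY.insert hy hyz)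
        (fun h => hYc (h.mono (Set.subset_insert z Y)))
        fun x hx => (hN x (hsub hx)).mono fun a ha => ⟨hsub ha.1, ha.2⟩
      refine ⟨z :: l, ⟨?_, h1⟩, ?_, by simp [h3]⟩
      · intro b hb
        rcases List.mem_cons.1 hb with rfl | hb
        · exact ⟨hvz.ne, by simp [hvz]⟩
        · have hzb := (h1.1 b hb).1
          have hbY := hYE ((h2 b hb).resolve_left hzb.symm)
          exact ⟨hbY.2.1.symm, by simp [hbY.2.2, hzb]⟩
      · intro b hb
        rcases List.mem_cons.1 hb with rfl | hb
        · exact hzD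
        · exact hsub (h2 b hb)

/-- Gyárfás: graphs without an induced path on `m` vertices are `χ`-bounded. -/
theorem colorableOn_of_forall_path [Finite V] {m : ℕ} (hm : 2 ≤ m) (q : ℕ) {X : Set V}
    (hX : G.CliqueFreeOn X (q + 2))
    (hP : ∀ l, G.IsInducedPath l → (∀ x ∈ l, x ∈ X) → l.length ≠ m) :
    G.ColorableOn X ((m - 1) ^ q) := by
  classical
  induction q generalizing X with
  | zero =>
    refine ⟨fun _ => 0, by simp, fun a ha b hb hab => ?_⟩
    refine absurd ?_ (hX (t := {a, b}) ?_)
    · refine ⟨?_, Finset.card_pair hab.ne⟩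
      simp only [Finset.coe_insert, Finset.coe_singleton, isClique_iff, Set.pairwise_pair]
      exact fun _ => ⟨hab, hab.symm⟩
    · simp [Set.insert_subset_iff, ha, hb]
  | succ q ih =>
    by_contra hcon
    rw [pow_succ'] at hcon
    obtain ⟨Y, hYX, ⟨v, hv⟩, hY, -, hYc⟩ := exists_component hcon
    -- Neighbourhoods have smaller cliques, so induction supplies the local bound; together with `v`
    -- the path has `m` vertices.
    obtain ⟨l, h1, h2, h3⟩ := exists_path_of_not_colorableOn (Nat.one_le_pow _ _ (by omega)) (m - 1)
      hv hY hYc fun x hx => ih (X := {y ∈ Y | G.Adj x y}) (fun T hT hTc => by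
        refine hX (t := insert x T) ?_ (hTc.insert fun b hb => (hT hb).2)
        rw [Finset.coe_insert, Set.insert_subset_iff]
        exact ⟨hYX hx, fun b hb => hYX (hT hb).1⟩)
        fun l hl hlY => hP l hl fun x hx => hYX (hlY x hx).1
    refine hP _ h1 (fun x hx => hYX ?_) (by simp [h3]; omega)
    rcases List.mem_cons.1 hx with rfl | hx
    · exact hv
    · exact h2 x hx

end Coloring

/-! ### Long induced paths in distance levels -/

section Levels

variable {V : Type u} {G : SimpleGraph V}

theorem Connected.exists_adj_dist (hG : G.Connected) {o x : V} (hx : G.dist o x ≠ 0) :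
    ∃ y, G.Adj y x ∧ G.dist o y + 1 = G.dist o x := by
  obtain ⟨p, hp⟩ := hG.exists_walk_length_eq_dist x o
  cases p with
  | nil => simp at hx
  | @cons _ y _ h p =>
    refine ⟨y, h.symm, ?_⟩
    have h1 : G.dist y o ≤ p.length := dist_le p
    have h2 := h.symm.diff_dist_adj (u := o)
    rw [Walk.length_cons] at hp
    rw [dist_comm (u := y)] at h1
    rw [dist_comm (u := x)] at hp
    omega

open Classical in
/-- A vertex with many neighbours among vertices attached to distinct blocks of an induced path
yields a fan. -/
theorem _root_.HasVertexMinor.fan_of_hub [Finite V] {k : ℕ} {w : V} {bs : List (V × List V)}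
    (h : G.IsInducedPath (bs.flatMap Prod.snd)) (hb : ∀ x ∈ bs, ∃ p ∈ x.2, G.Adj x.1 p)
    (hbs : bs.Pairwise fun x y => (∀ p ∈ y.2, ¬ G.Adj x.1 p) ∧ ∀ p ∈ x.2, ¬ G.Adj y.1 p)
    (hfst : ∀ x ∈ bs, x.1 ∉ bs.flatMap Prod.snd) (hw : w ∉ bs.flatMap Prod.snd)
    (hwb : ∀ p ∈ bs.flatMap Prod.snd, ¬ G.Adj w p) (E : Finset V)
    (hE : ∀ x ∈ E, x ∈ bs.map Prod.fst ∧ G.Adj w x) (hcard : 2 ^ (k + k) ≤ E.card) :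
    HasVertexMinor (fan k) G := by
  obtain ⟨G', hG', h1, T, hT, hTk, hTi⟩ := exists_indep_neighbors
    (P := {p | p ∈ bs.flatMap Prod.snd}) E hcard (fun e he => (hE e he).2) hwb
  have hG'w : ∀ y, G'.Adj w y ↔ G.Adj w y := by
    intro y
    rcases hG' with rfl | rfl
    · rfl
    · exact localComplement_adj_of_not_adj _ (G.loopless.irrefl w) y
  have hmem : ∀ x ∈ bs, ∀ p ∈ x.2, p ∈ bs.flatMap Prod.snd := fun x hx p hp =>
    List.mem_flatMap.2 ⟨x, hx, hp⟩
  refine .of_localReach h1 (.fan_of_blocks (L := []) (T := (T : Set V)) (w := w) (bs := bs)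
    ?_ ?_ ?_ ?_ (by simp) hw ?_)
  · exact h.congr fun x hx y _ => h1.adj_iff hx y
  · have hsub : T ⊆ ((bs.filter (fun x => x.1 ∈ (T : Set V))).map Prod.fst).toFinset := by
      intro s hs
      obtain ⟨x, hx, rfl⟩ := List.mem_map.1 (hE s (hT hs)).1
      simp only [List.mem_toFinset, List.mem_map, List.mem_filter]
      exact ⟨x, ⟨hx, by simpa using hs⟩, rfl⟩
    have := (Finset.card_le_card hsub).trans (List.toFinset_card_le _)
    rw [List.length_map, ← List.countP_eq_length_filter, hTk] at this
    simpa using this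
  · intro x hx hxT
    refine ⟨(hG'w _).2 (hE _ (hT hxT)).2, ?_, by simp, by simp, hfst x hx⟩
    obtain ⟨p, hp, hxp⟩ := hb x hx
    exact ⟨p, hp, (h1.adj_iff' (hmem x hx p hp) _).2 hxp⟩
  · refine hbs.imp_of_mem ?_
    intro x y hx hy hxy
    refine ⟨fun _ p hp => ?_, fun _ p hp => ?_, fun hxT hyT => ⟨?_, hTi _ hxT _ hyT⟩⟩
    · rw [h1.adj_iff' (hmem y hy p hp)]; exact hxy.1 p hp
    · rw [h1.adj_iff' (hmem x hx p hp)]; exact hxy.2 p hp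
    · intro he
      obtain ⟨p, hp, hxp⟩ := hb x hx
      exact hxy.2 p hp (he ▸ hxp)
  · intro p hp
    rw [hG'w]
    exact hwb p hp

open Classical in
/-- A long induced path inside a distance level of a connected graph yields a fan. -/
theorem _root_.HasVertexMinor.fan_of_level [Finite V] {k r : ℕ} (hk : 2 ≤ k) (hr : r = 2 ^ (k + k))
    (hG : G.Connected) (o : V) (t : ℕ) {l : List V} (h : G.IsInducedPath l)
    (ht : ∀ x ∈ l, G.dist o x = t)
    (hl : (r * (2 ^ (r + r) + 1) ^ r + 1) ^ (k - 1) ≤ l.length) :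
    HasVertexMinor (fan k) G := by
  have := Fintype.ofFinite V
  set n := r * (2 ^ (r + r) + 1) ^ r + 1 with hn
  have hrpos : 0 < r := by rw [hr]; positivity
  have hn2 : 2 ≤ n := by
    have : 0 < r * (2 ^ (r + r) + 1) ^ r := by positivity
    omega
  have hlen2 : 2 ≤ l.length := by
    refine le_trans hn2 (le_trans ?_ hl)
    exact Nat.le_self_pow (by omega) n
  have hroot : ∀ x, G.dist o x = 0 → x = o := fun x hx => (hG.dist_eq_zero_iff.1 hx).symm
  have ht0 : t ≠ 0 := by
    rintro rfl
    obtain ⟨a, b, l, rfl⟩ : ∃ a b l', l = a :: b :: l' := by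
      match l, hlen2 with
      | a :: b :: l, _ => exact ⟨a, b, l, rfl⟩
    refine (h.1 b (by simp)).1 ?_
    rw [hroot a (ht a (by simp)), hroot b (ht b (by simp))]
  by_cases hA : ∃ s, G.dist o s + 1 = t ∧ k ≤ l.countP (G.Adj s ·)
  · obtain ⟨s, hs, hsk⟩ := hA
    exact .fan_of_countP h (fun hsl => by have := ht s hsl; omega) hsk
  push Not at hA
  obtain ⟨bs, hbn, hbl, hbA, hbs⟩ := exists_blocks (G := G) {s | G.dist o s + 1 = t} (k - 1) n l hl
    (fun p hp => by
      obtain ⟨y, h1, h2⟩ := hG.exists_adj_dist (o := o) (x := p) (by rw [ht p hp]; exact ht0)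
      exact ⟨y, by rw [Set.mem_ofPred_eq, h2, ht p hp], h1⟩)
    fun s hs => by have := hA s hs; omega
  have hP : ∀ p ∈ bs.flatMap Prod.snd, G.dist o p = t := fun p hp => ht p (hbl.subset hp)
  have hfst : ∀ x ∈ bs, G.dist o x.1 + 1 = t := fun x hx => (hbA x hx).1
  have hnd : (bs.map Prod.fst).Nodup := by
    rw [List.Nodup, List.pairwise_map]
    refine hbs.imp_of_mem ?_
    intro x y hx hy hxy he
    obtain ⟨p, hp, hxp⟩ := (hbA x hx).2
    exact hxy.2 p hp (he ▸ hxp)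
  set S := (bs.map Prod.fst).toFinset with hS
  have hScard : S.card = n := by rw [hS, List.toFinset_card_of_nodup hnd, List.length_map, hbn]
  have hSd : ∀ s ∈ S, G.dist o s + 1 = t := by
    intro s hs
    obtain ⟨x, hx, rfl⟩ := List.mem_map.1 (List.mem_toFinset.1 hs)
    exact hfst x hx
  -- For `t = 1` all of `S` would be the root, but `S` has `n ≥ 2` elements; so level `t - 2`
  -- exists.
  have ht2 : 2 ≤ t := by
    by_contra hcon
    have : S ⊆ {o} := fun s hs => by
      have := hSd s hs
      exact Finset.mem_singleton.2 (hroot s (by omega))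
    have := Finset.card_le_card this
    rw [Finset.card_singleton] at this
    omega
  have hfar : ∀ x y, G.dist o x + 1 < G.dist o y → ¬ G.Adj x y := by
    intro x y hxy hadj
    have := hadj.diff_dist_adj (u := o)
    omega
  -- a vertex two levels below the path with many neighbours in `S` suffices
  have final : ∀ G' w (E : Finset V), LocalReach {p | p ∈ bs.flatMap Prod.snd} G G' →
      G.dist o w + 2 = t → r ≤ E.card → (∀ x ∈ E, x ∈ S ∧ G'.Adj w x) →
      HasVertexMinor (fan k) G := by
    intro G' w E hG' hw hE hwE
    have hmem : ∀ x ∈ bs, ∀ p ∈ x.2, p ∈ bs.flatMap Prod.snd := fun x hx p hp =>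
      List.mem_flatMap.2 ⟨x, hx, hp⟩
    refine .of_localReach hG' (.fan_of_hub (w := w) (bs := bs)
      ((h.infix hbl).congr fun x hx y _ => hG'.adj_iff hx y) ?_ ?_ ?_ ?_ ?_ E
      (fun x hx => ⟨by simpa [hS] using (hwE x hx).1, (hwE x hx).2⟩) (hr ▸ hE))
    · intro x hx
      obtain ⟨p, hp, hxp⟩ := (hbA x hx).2
      exact ⟨p, hp, (hG'.adj_iff' (hmem x hx p hp) _).2 hxp⟩
    · refine hbs.imp_of_mem ?_
      intro x y hx hy hxy
      refine ⟨fun p hp => ?_, fun p hp => ?_⟩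
      · rw [hG'.adj_iff' (hmem y hy p hp)]; exact hxy.1 p hp
      · rw [hG'.adj_iff' (hmem x hx p hp)]; exact hxy.2 p hp
    · intro x hx hxP
      have := hfst x hx
      have := hP _ hxP
      omega
    · intro hwP
      have := hP _ hwP
      omega
    · intro p hp
      rw [hG'.adj_iff' hp]
      exact hfar w p (by have := hP p hp; omega)
  by_cases hB : ∃ b, G.dist o b + 2 = t ∧ r ≤ (S.filter (G.Adj b ·)).card
  · obtain ⟨b, hb, hbr⟩ := hB
    exact final G b _ (.refl G) hb hbr fun x hx => Finset.mem_filter.1 hx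
  push Not at hB
  obtain ⟨D, hDB, hDcard, f, hfS, hf⟩ := exists_private (G := G)
    (B := Finset.univ.filter fun b => G.dist o b + 2 = t) (S := S) (ρ := r)
    (fun s hs => by
      have := hSd s hs
      obtain ⟨y, h1, h2⟩ := hG.exists_adj_dist (o := o) (x := s) (by omega)
      exact ⟨y, by simp only [Finset.mem_filter, Finset.mem_univ, true_and]; omega, h1⟩)
    fun b hb => (hB b (Finset.mem_filter.1 hb).2).le
  have hDd : ∀ d ∈ D, G.dist o d + 2 = t := fun d hd => (Finset.mem_filter.1 (hDB hd)).2
  -- This is what the choice of `n` is for: `n ≤ D.card * r`.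
  have hDr : (2 ^ (r + r) + 1) ^ r < D.card := by
    rw [hScard, hn, mul_comm] at hDcard
    exact Nat.lt_of_mul_lt_mul_right (Nat.lt_of_succ_le hDcard)
  have hW : ∀ x, x ∈ Finset.univ.filter (fun b => G.dist o b + 2 < t) ↔ G.dist o x + 2 < t := by
    simp
  have hconn : G.ConnectedOn
      (((Finset.univ.filter fun b => G.dist o b + 2 < t : Finset V) : Set V) ∪ (D : Set V)) := by
    intro c hc
    have key : ∀ j, ∀ x ∈ ((Finset.univ.filter fun b => G.dist o b + 2 < t : Finset V) : Set V) ∪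
        (D : Set V), G.dist o x = j → (c x ↔ c o) := by
      intro j
      induction j with
      | zero => intro x _ hxj; rw [hroot x hxj]
      | succ j ih =>
        intro x hx hxj
        obtain ⟨y, h1, h2⟩ := hG.exists_adj_dist (o := o) (x := x) (by omega)
        have hxt : G.dist o x + 2 ≤ t := by
          rcases hx with hx | hx
          · exact ((hW x).1 hx).le
          · exact (hDd x hx).le
        have hy : y ∈ ((Finset.univ.filter fun b => G.dist o b + 2 < t : Finset V) : Set V) ∪
          (D : Set V) := Or.inl ((hW y).2 (by omega))
        rw [← ih y hy (by omega)]
        exact ⟨hc x hx y hy h1.symm, hc y hy x hx h1⟩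
    exact fun a ha b hb hca => (key _ b hb rfl).2 ((key _ a ha rfl).1 hca)
  -- Levels below `t - 2` have no neighbours in `S` or on the path, so eliminating them keeps `D`
  -- connected and preserves all adjacencies with those vertices.
  obtain ⟨G₁, h1, hG₁⟩ := ConnectedOn.exists_localReach
    (Q := {p | p ∈ bs.flatMap Prod.snd} ∪ (S : Set V))
    (Finset.univ.filter fun b => G.dist o b + 2 < t) hconn
    (fun x hx hxD => by have := (hW x).1 hx; have := hDd x hxD; omega)
    (fun x hx p hp => hfar x p (by
      have := (hW x).1 hx
      rcases hp with hp | hp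
      · have := hP p hp; omega
      · have := hSd p hp; omega))
  obtain ⟨G₂, h2, w, hw, E, hEr, hE⟩ := exists_hub_of_connectedOn (f := f) (r := r)
    (P := {p | p ∈ bs.flatMap Prod.snd}) hG₁
    (fun d hd e he => by rw [h1.adj_iff' (Or.inr (hfS e he)), hf d hd e he])
    (fun e he hh => by have := hSd _ (hfS e he); have := hDd _ hh; omega)
    (fun d hd p hp => by
      rw [h1.adj_iff' (Or.inl hp)]
      exact hfar d p (by have := hP p hp; have := hDd d hd; omega))
    hDr
  refine final G₂ w E ((h1.mono Set.subset_union_left).trans h2) (hDd w hw) hEr fun x hx => ?_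
  obtain ⟨hx1, hx2⟩ := hE x hx
  obtain ⟨e, he, rfl⟩ := Finset.mem_image.1 hx1
  exact ⟨hfS e he, hx2⟩

/-- A bound on the chromatic number of graphs without a fan vertex-minor, for every `m` that is
large enough. -/
theorem colorable_of_not_hasVertexMinor_fan [Finite V] {k r m : ℕ} (hk : 2 ≤ k)
    (hr : r = 2 ^ (k + k)) (hm : (r * (2 ^ (r + r) + 1) ^ r + 1) ^ (k - 1) ≤ m) (hm2 : 2 ≤ m)
    (hG : ¬ HasVertexMinor (fan k) G) (q : ℕ) (hq : G.CliqueFree (q + 2)) :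
    G.Colorable (2 * (m - 1) ^ q) := by
  rw [colorable_iff_forall_connectedComponent]
  intro C
  have hC : ¬ HasVertexMinor (fan k) C.toSimpleGraph := fun h => hG (.of_induce G C.supp h)
  have hCq : C.toSimpleGraph.CliqueFree (q + 2) := hq.comap ⟨(Embedding.induce C.supp).toCopy⟩
  have hconn := C.connected_toSimpleGraph
  generalize C.toSimpleGraph = K at hC hCq hconn
  obtain ⟨o⟩ := hconn.nonempty
  have hlev : ∀ t, K.ColorableOn {x | K.dist o x = t} ((m - 1) ^ q) := fun t =>
    colorableOn_of_forall_path hm2 q (fun T _ => hCq T) fun l hl hlt hlm =>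
      hC (.fan_of_level hk hr hconn o t hl hlt (hlm ▸ hm))
  choose c hc1 hc2 using hlev
  have hpos : 0 < (m - 1) ^ q := Nat.pow_pos (by omega)
  -- Parity separates consecutive levels; the second coordinate separates adjacent vertices within a
  -- level.
  have col := (Coloring.mk (α := Fin 2 × Fin ((m - 1) ^ q)) (G := K) (fun x =>
    (⟨K.dist o x % 2, by omega⟩, ⟨c (K.dist o x) x, hc1 _ x rfl⟩)) ?_).colorable
  · simpa using col
  · intro x y hxy heq
    simp only [Prod.mk.injEq, Fin.mk.injEq] at heq
    have hd := hxy.diff_dist_adj (u := o)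
    have hxy' : K.dist o y = K.dist o x := by omega
    rw [hxy'] at heq
    exact hc2 _ x rfl y hxy' hxy heq.2

end Levels

/-! ### Comparison with the stated constants -/

section RamseyNumber

theorem exists_ramsey (a b : ℕ) {V : Type*} [Fintype V] (G : SimpleGraph V)
    (h : 2 ^ (a + b) ≤ Fintype.card V) :
    (∃ s : Finset V, G.IsNClique a s) ∨ ∃ s : Finset V, G.IsNIndepSet b s := by
  rcases G.exists_isNClique_or_isNIndepSet a b Finset.univ h with ⟨T, -, hT⟩ | ⟨T, -, hT⟩
  · exact Or.inl ⟨T, hT⟩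
  · exact Or.inr ⟨T, hT⟩

/-- Edgeless graphs on fewer than `b` vertices are counterexamples. `exists_ramsey` shows that the
infimum is over a nonempty set, so it is not the default `0`. -/
theorem le_ramseyNumber {a : ℕ} (ha : 2 ≤ a) (b : ℕ) : b ≤ ramseyNumber a b := by
  refine le_csInf ⟨2 ^ (a + b), fun V _ G h => exists_ramsey a b G h⟩ fun n hn => ?_
  by_contra hlt
  rcases hn (Fin n) ⊥ (by simp) with ⟨s, hs⟩ | ⟨s, hs⟩
  · have hc := hs.card_eq
    obtain ⟨x, hx, y, hy, hxy⟩ := Finset.one_lt_card.1 (by omega : 1 < s.card)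
    exact hs.isClique hx hy hxy
  · have hc := hs.card_eq
    have := Finset.card_le_univ s
    rw [Fintype.card_fin] at this
    omega

theorem three_le_fanEll {k : ℕ} (hk : 3 ≤ k) : 3 ≤ fanEll k := by
  have h1 : k ≤ ramseyNumber k k := le_ramseyNumber (by omega) k
  have h2 : 2 * (k - 1) ^ 2 - 1 ≠ 0 := by
    have : 0 < (k - 1) ^ 2 := Nat.pow_pos (by omega)
    omega
  have := Nat.le_self_pow h2 (ramseyNumber k k)
  unfold fanEll
  omega

/-- The left side is at most `2 ^ 2 ^ (6 * k)`. On the right, the crude bound `3 * k` for the Ramsey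
number already makes the inner exponent at least `6 * k`, and `k - 1 ≥ 2`. -/
theorem pow_le_fanM {k : ℕ} (hk : 3 ≤ k) :
    (2 ^ (k + k) * (2 ^ (2 ^ (k + k) + 2 ^ (k + k)) + 1) ^ 2 ^ (k + k) + 1) ^ (k - 1) ≤ fanM k := by
  have hR : k * 3 ≤ ramseyNumber (k + 1) (k * fanEll k) :=
    (Nat.mul_le_mul_left k (three_le_fanEll hk)).trans (le_ramseyNumber (by omega) _)
  set r := 2 ^ (k + k) with hr
  have hr1 : 1 ≤ r := Nat.one_le_two_pow
  have hkr : k + k ≤ r := Nat.lt_two_pow_self.le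
  have h1 : (2 ^ (r + r) + 1) ^ r ≤ 2 ^ ((r + r + 1) * r) := by
    rw [pow_mul]
    refine Nat.pow_le_pow_left ?_ r
    have : 1 ≤ 2 ^ (r + r) := Nat.one_le_two_pow
    rw [pow_succ]
    omega
  have h2 : r * (2 ^ (r + r) + 1) ^ r + 1 ≤ 2 ^ (k + k + (r + r + 1) * r + 1) := by
    have : r * (2 ^ (r + r) + 1) ^ r ≤ 2 ^ (k + k + (r + r + 1) * r) := by
      rw [pow_add 2 (k + k), ← hr]
      exact Nat.mul_le_mul_left r h1
    have h3 : 1 ≤ 2 ^ (k + k + (r + r + 1) * r) := Nat.one_le_two_pow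
    rw [pow_succ]
    omega
  have h3 : (k + k + (r + r + 1) * r + 1) * (k - 1) ≤ 2 ^ (6 * k) := by
    have e1 : k + k + (r + r + 1) * r + 1 ≤ 2 ^ (4 * k + 3) := by
      have : 2 ^ (4 * k + 3) = 8 * (r * r) := by rw [hr]; ring
      nlinarith
    calc _ ≤ 2 ^ (4 * k + 3) * 2 ^ (k) :=
          Nat.mul_le_mul e1 ((Nat.sub_le k 1).trans Nat.lt_two_pow_self.le)
      _ = 2 ^ (5 * k + 3) := by rw [← pow_add]; congr 1; ring
      _ ≤ 2 ^ (6 * k) := Nat.pow_le_pow_right (by norm_num) (by omega)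
  calc _ ≤ (2 ^ (k + k + (r + r + 1) * r + 1)) ^ (k - 1) := Nat.pow_le_pow_left h2 _
    _ = 2 ^ ((k + k + (r + r + 1) * r + 1) * (k - 1)) := by rw [← pow_mul]
    _ ≤ 2 ^ ((k - 1) ^ (2 * ramseyNumber (k + 1) (k * fanEll k) + 1) + 1) := by
        refine Nat.pow_le_pow_right (by norm_num) (h3.trans (le_trans ?_ (Nat.le_succ _)))
        exact (Nat.pow_le_pow_right (by norm_num) (by omega)).trans
          (Nat.pow_le_pow_left (by omega) _)
    _ ≤ fanM k := Nat.pow_le_pow_left (by omega) _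

theorem two_le_fanM {k : ℕ} (hk : 3 ≤ k) : 2 ≤ fanM k :=
  (by omega : 2 ≤ k - 1).trans (Nat.le_self_pow (Nat.succ_ne_zero _) _)

end RamseyNumber

/-! ### Fans with at most two path vertices -/

section SmallFan

variable {V : Type u} {G : SimpleGraph V}

/-- The edges form a matching; in an arbitrary linear order the lower end of each edge gets its own
colour. -/
theorem colorable_two_of_forall_adj (h : ∀ x y z, G.Adj x y → G.Adj x z → y = z) :
    G.Colorable 2 := by
  classical
  have := linearOrderOfSTO (α := V) WellOrderingRel
  refine ⟨Coloring.mk (fun x => if ∃ y, G.Adj x y ∧ x < y then (0 : Fin 2) else 1) ?_⟩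
  have key : ∀ x y, G.Adj x y → x < y →
      (if ∃ z, G.Adj x z ∧ x < z then (0 : Fin 2) else 1) ≠
        if ∃ z, G.Adj y z ∧ y < z then (0 : Fin 2) else 1 := by
    intro x y hxy hlt
    rw [if_pos ⟨y, hxy, hlt⟩, if_neg]
    · decide
    · rintro ⟨z, hyz, hz⟩
      rw [h y z x hyz hxy.symm] at hz
      exact lt_asymm hlt hz
  intro x y hxy
  rcases lt_trichotomy x y with hlt | rfl | hlt
  · exact key x y hxy hlt
  · exact absurd hxy (G.loopless.irrefl x)
  · exact (key y x hxy.symm hlt).symm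

/-- Two neighbours of a vertex span a triangle with it, possibly after complementing there, and a
triangle contains these fans. -/
theorem colorable_two_of_not_hasVertexMinor_fan [Finite V] {k : ℕ} (hk : k ≤ 2)
    (hG : ¬ HasVertexMinor (fan k) G) : G.Colorable 2 := by
  have key : ∀ (K : SimpleGraph V) x y z, K.Adj x y → K.Adj x z → K.Adj y z →
      HasVertexMinor (fan k) K := by
    intro K x y z hxy hxz hyz
    refine .fan_of_forall_adj (u := x) (l := [y, z]) ?_ hk (by simp [hxy, hxz])
    simp [IsInducedPath, hyz, hyz.ne]
  refine colorable_two_of_forall_adj fun x y z hxy hxz => ?_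
  by_contra hyz
  by_cases hadj : G.Adj y z
  · exact hG (key G x y z hxy hxz hadj)
  · have hx := G.loopless.irrefl x
    refine hG (.of_localComplement G x (key _ x y z ?_ ?_ (Or.inl ⟨hxy, hxz, hyz, hadj⟩)))
    · exact (localComplement_adj_of_not_adj G hx y).2 hxy
    · exact (localComplement_adj_of_not_adj G hx z).2 hxz

end SmallFan

theorem colorable_fanM {V : Type u} [Finite V] {G : SimpleGraph V} {k q : ℕ} (hk : 3 ≤ k)
    (hq : 1 ≤ q) (hG : ¬ HasVertexMinor (fan k) G) (hGq : G.cliqueNum ≤ q) :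
    G.Colorable (2 * (fanM k - 1) ^ (q - 1)) := by
  refine colorable_of_not_hasVertexMinor_fan (by omega) rfl (pow_le_fanM hk) (two_le_fanM hk) hG
    (q - 1) fun T hT => ?_
  have h1 := hT.isClique.card_le_cliqueNum
  have h2 := hT.card_eq
  omega

end SimpleGraph

theorem mainTheorem1 (k : ℕ) :
    IsChiBounded.{u} (fun _ G => ¬ HasVertexMinor (fan k) G) ∧
    (k ≤ 2 → ∀ (V : Type u) [Finite V] (G : SimpleGraph V),
      ¬ HasVertexMinor (fan k) G → G.Colorable 2) ∧
    (3 ≤ k → ∀ q : ℕ, 1 ≤ q → ∀ (V : Type u) [Finite V] (G : SimpleGraph V),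
      ¬ HasVertexMinor (fan k) G → G.cliqueNum ≤ q →
        G.Colorable (2 * (fanM k - 1) ^ (q - 1))) := by
  refine ⟨?_, fun hk V _ G hG => SimpleGraph.colorable_two_of_not_hasVertexMinor_fan hk hG,
    fun hk q hq V _ G hG hGq => SimpleGraph.colorable_fanM hk hq hG hGq⟩
  by_cases hk : k ≤ 2
  · refine ⟨fun _ => 2, fun V _ G hG S => ?_⟩
    exact (SimpleGraph.colorable_two_of_not_hasVertexMinor_fan hk
      fun h => hG (.of_induce G S h)).chromaticNumber_le
  · refine ⟨fun q => 2 * (fanM k - 1) ^ q, fun V _ G hG S => ?_⟩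
    -- Taking clique number plus one meets `1 ≤ q` even for the empty subgraph.
    exact (SimpleGraph.colorable_fanM (q := _ + 1) (by omega) (Nat.le_add_left 1 _)
      (fun h => hG (.of_induce G S h)) (Nat.le_succ _)).chromaticNumber_le
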